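/- Let $K$ be a field and $V$ a $K$-vector space; all tensor products are over $K$, and $TV=\bigoplus_n V^{\otimes n}$ is the tensor algebra. **Trees.** A grading tree is a finite full binary tree; $\bullet$ is the trivial one, $t\vee u$ is the tree whose root has the subtrees $t$ (left) and $u$ (right), and $\ell(t)$ is the number of leaves of $t$. For a module $M$ put $\mathcal T M=\bigoplus_t M^{\otimes \ell(t)}$ (sum over all grading trees), with the products $M^{\otimes\ell(t)}\otimes M^{\otimes\ell(u)}\to M^{\otimes\ell(t\vee u)}$, $a\otimes b\mapsto a\vee b$, given by concatenation; $\mathcal T K$ is free on the grading trees. A generating tree $\sigma$ for $V$ is an infinite rooted tree in which every node $r$ carries a label $\sigma\langle r\rangle\in V\oplus K$ and has, for some $n\ge 1$ depending on the node, exactly $2n$ children, named $L(1),\dots,L(n),R(1),\dots,R(n)$. Given a grading tree $t$ with leaves $p_1,\dots,p_m$ from left to right, and a choice $\iota$ of a positive integer for every inner node of $t$, let $r_k$ be the sequence of symbols $L(i)$, $R(i)$ obtained from the path (a word in $L,R$) from the root of $t$ to $p_k$ by decorating each step with the integer chosen at the inner node where it starts. The homomorphism $f\colon\mathcal TK\to\mathcal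 T(V\oplus K)$ generated by $\sigma$ is given by $f(t)=\sum_\iota \sigma\langle r_1\rangle\otimes\cdots\otimes\sigma\langle r_m\rangle\in (V\oplus K)^{\otimes \ell(t)}$, the sum over those $\iota$ for which all $r_k$ are nodes of $\sigma$. For a tuple $\vec\alpha=(\alpha_1,\dots,\alpha_m)$ with each $\alpha_k$ one of the projections $\mathrm{pr}_V,\mathrm{pr}_K$ of $V\oplus K$, and with $\deg\vec\alpha$ the number of $\mathrm{pr}_V$'s in it, put $\sigma\langle t\mid\vec\alpha\rangle=\sum_\iota\alpha_1(\sigma\langle r_1\rangle)\otimes\cdots\otimes\alpha_m(\sigma\langle r_m\rangle)\in V^{\otimes\deg\vec\alpha}$. The tree $\sigma$ is weakly normal if $\sigma\langle t\mid\vec\alpha\rangle=\sigma\langle u\mid\vec\beta\rangle$ whenever $\deg\vec\alpha=\deg\vec\beta$, and normal if the subtree under each of its nodes is weakly normal. Let $\mathrm{Nor}(V)$ be the set, in fact a submodule of $\mathrm{Hom}(\mathcal TK,\mathcal T(V\oplus K))$, of all $f$ generated by a normal generating tree. **Block–Leroux.** Let $\mathrm{BL}(V)$ be the space of the linear maps $f\colon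 K[X]\to TV$ that preserve degrees and for which there are finite families $(g_i),(h_i)$ of linear maps $K[X]\to TV$ with $f(pq)=\sum_i g_i(p)h_i(q)$ for all $p,q\in K[X]$. **Claim.** 1. $\mathrm{Nor}(V)$ is a coalgebra with $\delta(f)=\sum_i g_i\otimes h_i$ for any finite families $(g_i),(h_i)$ in $\mathrm{Nor}(V)$ with $f(t\vee u)=\sum_i g_i(t)\vee h_i(u)$ for all $t,u$ (such families exist for every $f$), and $\varepsilon(f)=\mathrm{pr}_K(f(\bullet))$. $\mathrm{BL}(V)$ is a coalgebra with $\delta_{\mathrm{BL}}(f)=\sum_i g_i\otimes h_i$ for any finite families $(g_i),(h_i)$ in $\mathrm{BL}(V)$ with $f(pq)=\sum_i g_i(p)h_i(q)$ for all $p,q$ (such families exist for every $f$), and $\varepsilon_{\mathrm{BL}}(f)=f(1)$. 2. There is an isomorphism of coalgebras $\tilde\varphi\colon\mathrm{Nor}(V)\to\mathrm{BL}(V)$ such that, for every $f\in\mathrm{Nor}(V)$, $\tilde\varphi(f)(1)=\mathrm{pr}_K(f(\bullet))$ and $\tilde\varphi(f)(X^n)=\mathrm{pr}_V^{\otimes n}(f(t_n))$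 for $n\ge1$, where $t_n$ is the left comb with $n$ leaves ($t_1=\bullet$, $t_{n+1}=t_n\vee\bullet$). Moreover, for every normal generating tree $\sigma$ that generates $f$, every grading tree $t$ and every projection tuple $\vec\alpha$ for $t$, $\tilde\varphi(f)(X^{\deg\vec\alpha})=\sigma\langle t\mid\vec\alpha\rangle$. 3. $\tilde\varphi$ commutes with the projections to $V$: $\tilde\varphi(f)(X)=\mathrm{pr}_V(f(\bullet))$ for all $f\in\mathrm{Nor}(V)$. -/

import Mathlib

open scoped TensorProduct DirectSum Polynomial

universe u v

                                          
/-! ### Grading trees and tree-tensor algebras -/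

/-- Finite full binary trees: the trivial tree, and the tree whose root has the two subtrees
`t`, `u`. -/
inductive GradingTree : Type
  | triv : GradingTree
  | join : GradingTree → GradingTree → GradingTree
  deriving DecidableEq

namespace GradingTree

/-- The number of leaves. -/
def leaf : GradingTree → ℕ
  | triv => 1
  | join t u => leaf t + leaf u

/-- `comb n` is the left comb with `n + 1` leaves. -/
def comb : ℕ → GradingTree
  | 0 => triv
  | n + 1 => join (comb n) triv

theorem leaf_pos : ∀ t : GradingTree, 0 < t.leaf
  | triv => Nat.one_pos
  | join t _ => Nat.add_pos_left (leaf_pos t) _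

end GradingTree

/-- The component of the tree-tensor algebra in degree `t`: the tensor power `M^{⊗ leaf t}`. -/
abbrev TreePower (K : Type u) [CommRing K] (M : Type v) [AddCommGroup M] [Module K M]
    (t : GradingTree) : Type (max u v) :=
  ⨂[K]^(t.leaf) M

/-- The tree-tensor algebra of `M`. -/
abbrev TreeTensor (K : Type u) [CommRing K] (M : Type v) [AddCommGroup M] [Module K M] :
    Type (max u v) :=
  ⨁ t : GradingTree, TreePower K M t

/-- The product of the tree-tensor algebra: concatenation of tensors
`M^{⊗ leaf t} ⊗ M^{⊗ leaf u} → M^{⊗ leaf (join t u)}`. -/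
noncomputable def treeMul {K : Type u} [CommRing K] {M : Type v} [AddCommGroup M] [Module K M]
    {t u : GradingTree} (a : TreePower K M t) (b : TreePower K M u) :
    TreePower K M (GradingTree.join t u) :=
  TensorPower.mulEquiv (n := t.leaf) (m := u.leaf) (a ⊗ₜ[K] b)

/-- The grading tree `t`, as an element `1 ⊗ ⋯ ⊗ 1` of the tree-tensor algebra of `K`. These
elements form a basis. -/
noncomputable def treeBasis (K : Type u) [CommRing K] (t : GradingTree) : TreeTensor K K :=
  DirectSum.lof K GradingTree (TreePower K K) t (PiTensorProduct.tprod K fun _ => (1 : K))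

/-- Homomorphisms from the tree-tensor algebra of `K` to that of `V ⊕ K`. -/
abbrev TreeHom (K : Type u) [CommRing K] (V : Type v) [AddCommGroup V] [Module K V] :
    Type (max u v) :=
  TreeTensor K K →ₗ[K] TreeTensor K (V × K)

/-- The value `f(t)` of a (tree-graded) homomorphism, as an element of `(V ⊕ K)^{⊗ leaf t}`. -/
noncomputable def TreeHom.value {K : Type u} [CommRing K] {V : Type v} [AddCommGroup V]
    [Module K V] (f : TreeHom K V) (t : GradingTree) : TreePower K (V × K) t :=
  DirectSum.component K GradingTree (TreePower K (V × K)) t (f (treeBasis K t))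

/-- The value of `f` at the trivial tree, as an element of `V ⊕ K`. -/
noncomputable def TreeHom.rootValue {K : Type u} [CommRing K] {V : Type v} [AddCommGroup V]
    [Module K V] (f : TreeHom K V) : V × K :=
  PiTensorProduct.subsingletonEquiv (R := K) (s := fun _ : Fin 1 => V × K) (0 : Fin 1)
    (f.value GradingTree.triv)

/-! ### Generating trees -/

/-- The two kinds of children, `L` and `R`. -/
inductive Side : Type
  | L : Side
  | R : Side
  deriving DecidableEq

/-- Position sequences. The children `L(1), …, L(n), R(1), …, R(n)` of a node are numbered here
from `0` to `n - 1` on each side, and sequences are read from the root. -/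
abbrev Position : Type := List (Side × ℕ)

/-- Generating trees for `V`. The node at position `r` has the `2 * width r` children
`r ++ [(d, i)]`, `i < width r`, and `width r` is positive. The data at positions that are not
nodes (see `GenTree.IsNode`) are irrelevant. -/
@[ext]
structure GenTree (K : Type u) (V : Type v) : Type (max u v) where
  width : Position → ℕ
  width_pos : ∀ r, 0 < width r
  label : Position → V × K

namespace GenTree

/-- The subtree under the position `r`. -/
def subtree {K : Type u} {V : Type v} (σ : GenTree K V) (r : Position) : GenTree K V where
  width s := σ.width (r ++ s)
  width_pos s := σ.width_pos (r ++ s)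
  label s := σ.label (r ++ s)

/-- The number `n` such that the root has the children `L(1), …, L(n), R(1), …, R(n)`. -/
abbrev rootWidth {K : Type u} {V : Type v} (σ : GenTree K V) : ℕ := σ.width []

/-- The subtree under the child `(d, i)` of the root. -/
abbrev child {K : Type u} {V : Type v} (σ : GenTree K V) (d : Side) (i : ℕ) : GenTree K V :=
  σ.subtree [(d, i)]

/-- The position sequence `r` specifies a node of `σ`. -/
def IsNode {K : Type u} {V : Type v} : GenTree K V → Position → Prop
  | _, [] => True
  | σ, (d, i) :: r => i < σ.rootWidth ∧ IsNode (σ.child d i) r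

/-- The choices `ι` of a number for every inner node of the grading tree `t`, such that all the
resulting position sequences specify nodes of `σ`: the number at the root of `t` is bounded by the
width of the root of `σ`, the numbers at the nodes of the two subtrees are bounded by the widths
in the corresponding subtrees of `σ`. -/
def Choice {K : Type u} {V : Type v} : GradingTree → GenTree K V → Type
  | .triv, _ => Unit
  | .join t u, σ =>
      Σ i : Fin σ.rootWidth, Choice t (σ.child .L i) × Choice u (σ.child .R i)

/-- There are finitely many choices. -/
instance instFintypeChoice {K : Type u} {V : Type v} :
    ∀ (t : GradingTree) (σ : GenTree K V), Fintype (Choice t σ)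
  | .triv, _ => inferInstanceAs (Fintype Unit)
  | .join t u, σ =>
      let _ : ∀ i : Fin σ.rootWidth,
          Fintype (Choice t (σ.child .L i) × Choice u (σ.child .R i)) := fun i =>
        let _ := instFintypeChoice t (σ.child .L i)
        let _ := instFintypeChoice u (σ.child .R i)
        inferInstance
      inferInstanceAs
        (Fintype (Σ i : Fin σ.rootWidth, Choice t (σ.child .L i) × Choice u (σ.child .R i)))

/-- The position sequences `r_1, …, r_n` belonging to the leaves of `t`, from left to right, for a
choice `ι`: the path from the root of `t` to the leaf, each step decorated with the number that `ι`
gives to the inner node at which the step starts. -/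
def leafPosition {K : Type u} {V : Type v} :
    ∀ (t : GradingTree) (σ : GenTree K V), Choice t σ → Fin t.leaf → Position
  | .triv, _, _ => fun _ => []
  | .join t u, σ, ι =>
      Fin.append
        (fun k => (Side.L, (ι.1 : ℕ)) :: leafPosition t (σ.child .L ι.1) ι.2.1 k)
        (fun k => (Side.R, (ι.1 : ℕ)) :: leafPosition u (σ.child .R ι.1) ι.2.2 k)

/-- `∑_ι M(σ⟨r_1⟩, …, σ⟨r_n⟩)`. -/
def leafSum {K : Type u} {V : Type v} {W : Type*} [AddCommMonoid W] (σ : GenTree K V)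
    (t : GradingTree) (M : (Fin t.leaf → V × K) → W) : W :=
  ∑ ι : Choice t σ, M fun k => σ.label (leafPosition t σ ι k)

section Module

variable {K : Type u} [CommRing K] {V : Type v} [AddCommGroup V] [Module K V]

/-- `∑_ι σ⟨r_1⟩ ⊗ ⋯ ⊗ σ⟨r_n⟩`, the value at `t` of the homomorphism generated by `σ`. -/
noncomputable def treeValue (σ : GenTree K V) (t : GradingTree) : TreePower K (V × K) t :=
  σ.leafSum t fun x => PiTensorProduct.tprod K x

/-- `f` is the homomorphism generated by `σ`. -/
def Generates (σ : GenTree K V) (f : TreeHom K V) : Prop :=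
  ∀ t : GradingTree,
    f (treeBasis K t) = DirectSum.lof K GradingTree (TreePower K (V × K)) t (σ.treeValue t)

/-- The projections `pr_V` (for `true`) and `pr_K` (for `false`) of `V ⊕ K`, with values in the
degree-one and degree-zero part of the tensor algebra of `V`. -/
noncomputable def projTo (K : Type u) [CommRing K] (V : Type v) [AddCommGroup V] [Module K V] :
    Bool → V × K →ₗ[K] TensorAlgebra K V
  | true => TensorAlgebra.ι K ∘ₗ LinearMap.fst K V K
  | false => Algebra.linearMap K (TensorAlgebra K V) ∘ₗ LinearMap.snd K V K

/-- The number of `pr_V`'s in a projection tuple. -/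
def projDeg {n : ℕ} (α : Fin n → Bool) : ℕ := (Finset.univ.filter fun k => α k = true).card

/-- `σ⟨t | α⟩ = ∑_ι α_1(σ⟨r_1⟩) ⊗ ⋯ ⊗ α_n(σ⟨r_n⟩)`. The tensor product of `a` copies of `V` and
`n - a` copies of `K` is identified with `V^{⊗ a}`, the degree-`a` part of the tensor algebra;
the tensor product of the factors becomes their product. -/
noncomputable def projValue (σ : GenTree K V) (t : GradingTree) (α : Fin t.leaf → Bool) :
    TensorAlgebra K V :=
  σ.leafSum t fun x => (List.ofFn fun k => projTo K V (α k) (x k)).prod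

/-- Weakly normal generating trees: `σ⟨t | α⟩` depends only on the degree of `α`. -/
def WeaklyNormal (σ : GenTree K V) : Prop :=
  ∀ (t u : GradingTree) (α : Fin t.leaf → Bool) (β : Fin u.leaf → Bool),
    projDeg α = projDeg β → σ.projValue t α = σ.projValue u β

/-- Normal generating trees: the subtree under every node is weakly normal. -/
def Normal (σ : GenTree K V) : Prop :=
  ∀ s : Position, σ.IsNode s → (σ.subtree s).WeaklyNormal

/-! Closure of normal homomorphisms under the module operations. -/

theorem subtree_nil (σ : GenTree K V) : σ.subtree [] = σ := rfl

theorem normal_iff (σ : GenTree K V) :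
    σ.Normal ↔ σ.WeaklyNormal ∧ ∀ d i, i < σ.rootWidth → (σ.child d i).Normal := by
  constructor
  · intro h
    exact ⟨h [] trivial, fun d i hi s hs => h ((d, i) :: s) ⟨hi, hs⟩⟩
  · rintro ⟨h0, h1⟩ s hs
    match s, hs with
    | [], _ => exact h0
    | (d, i) :: s, hs => exact h1 d i hs.1 s hs.2

theorem leafSum_triv {W : Type*} [AddCommMonoid W] (σ : GenTree K V)
    (M : (Fin GradingTree.triv.leaf → V × K) → W) :
    σ.leafSum .triv M = M fun _ => σ.label [] :=
  Fintype.sum_unique (ι := Unit) _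

theorem leafSum_join {W : Type*} [AddCommMonoid W] (σ : GenTree K V) (t u : GradingTree)
    (M : (Fin (GradingTree.join t u).leaf → V × K) → W) :
    σ.leafSum (.join t u) M =
      ∑ i : Fin σ.rootWidth, (σ.child .L i).leafSum t fun x =>
        (σ.child .R i).leafSum u fun y => M (Fin.append x y) := by
  unfold leafSum
  refine (Fintype.sum_sigma _).trans (Finset.sum_congr rfl fun i _ => ?_)
  refine (Fintype.sum_prod_type _).trans ?_
  refine Finset.sum_congr rfl fun a _ => Finset.sum_congr rfl fun b _ => congrArg M ?_
  funext k
  refine Fin.addCases (fun k => ?_) (fun k => ?_) k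
  · rw [Fin.append_left]
    simp only [leafPosition]
    erw [Fin.append_left]
    rfl
  · rw [Fin.append_right]
    simp only [leafPosition]
    erw [Fin.append_right]
    rfl

/-- The tree with all widths `1` and all labels `0`. -/
def zeroTree (K : Type u) [CommRing K] (V : Type v) [AddCommGroup V] : GenTree K V where
  width _ := 1
  width_pos _ := Nat.one_pos
  label _ := 0

/-- The trees `σ` and `τ` joined at the root, with the sum of the labels there. -/
def addTree (σ τ : GenTree K V) : GenTree K V where
  width
    | [] => σ.rootWidth + τ.rootWidth
    | (d, i) :: s => if i < σ.rootWidth then σ.width ((d, i) :: s)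
        else τ.width ((d, i - σ.rootWidth) :: s)
  width_pos
    | [] => Nat.add_pos_left (σ.width_pos []) _
    | (d, i) :: s => by
        dsimp only
        split
        exacts [σ.width_pos _, τ.width_pos _]
  label
    | [] => σ.label [] + τ.label []
    | (d, i) :: s => if i < σ.rootWidth then σ.label ((d, i) :: s)
        else τ.label ((d, i - σ.rootWidth) :: s)

/-- The tree `σ` with the labels at the positions `L(i_1) ⋯ L(i_a)` multiplied by `c`. -/
def smulTree (c : K) (σ : GenTree K V) : GenTree K V where
  width := σ.width
  width_pos := σ.width_pos
  label r := if ∀ p ∈ r, p.1 = Side.L then c • σ.label r else σ.label r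

theorem addTree_child_lt (σ τ : GenTree K V) (d : Side) {i : ℕ} (h : i < σ.rootWidth) :
    (addTree σ τ).child d i = σ.child d i := by
  ext1 <;> funext s <;> simp [subtree, addTree, h]

theorem addTree_child_add (σ τ : GenTree K V) (d : Side) (i : ℕ) :
    (addTree σ τ).child d (σ.rootWidth + i) = τ.child d i := by
  ext1 <;> funext s <;> simp [subtree, addTree]

theorem smulTree_child_L (c : K) (σ : GenTree K V) (i : ℕ) :
    (smulTree c σ).child .L i = smulTree c (σ.child .L i) := by
  ext1
  · rfl
  · funext s
    have h : (∀ p ∈ (Side.L, i) :: s, p.1 = Side.L) ↔ ∀ p ∈ s, p.1 = Side.L :=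
      List.forall_mem_cons.trans (and_iff_right rfl)
    exact if_congr h rfl rfl

theorem smulTree_child_R (c : K) (σ : GenTree K V) (i : ℕ) :
    (smulTree c σ).child .R i = σ.child .R i := by
  ext1 <;> funext s <;> simp [subtree, smulTree]

theorem leafSum_zero {W : Type*} [AddCommMonoid W] (t : GradingTree)
    (M : (Fin t.leaf → V × K) → W) (hM : M 0 = 0) : (zeroTree K V).leafSum t M = 0 :=
  Finset.sum_eq_zero fun _ _ => hM

theorem leafSum_add {W : Type*} [AddCommMonoid W] (σ τ : GenTree K V) (t : GradingTree)
    (M : (Fin t.leaf → V × K) → W)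
    (hM : t = .triv → ∀ x y, M (x + y) = M x + M y) :
    (addTree σ τ).leafSum t M = σ.leafSum t M + τ.leafSum t M := by
  cases t with
  | triv =>
    rw [leafSum_triv, leafSum_triv, leafSum_triv, ← hM rfl]
    rfl
  | join t u =>
    rw [leafSum_join, leafSum_join, leafSum_join]
    have h : (addTree σ τ).rootWidth = σ.rootWidth + τ.rootWidth := rfl
    refine (Fin.sum_univ_add (a := σ.rootWidth) (b := τ.rootWidth) _).trans ?_
    congr 1
    · refine Finset.sum_congr rfl fun i _ => ?_
      simp only [Fin.val_castAdd, addTree_child_lt _ _ _ i.2]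
    · refine Finset.sum_congr rfl fun i _ => ?_
      simp only [Fin.val_natAdd, addTree_child_add]

theorem leafSum_smul {W : Type*} [AddCommMonoid W] [Module K W] (c : K) (t : GradingTree) :
    ∀ (σ : GenTree K V) (M : (Fin t.leaf → V × K) → W),
      (∀ x, M (fun k => if k.val = 0 then c • x k else x k) = c • M x) →
        (smulTree c σ).leafSum t M = c • σ.leafSum t M := by
  induction t with
  | triv =>
    intro σ M hM
    rw [leafSum_triv, leafSum_triv, ← hM]
    congr 1
    funext k
    have : k.val = 0 := Nat.lt_one_iff.1 k.2
    simp [this, smulTree]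
  | join t u iht _ =>
    intro σ M hM
    rw [leafSum_join, leafSum_join, Finset.smul_sum]
    refine Finset.sum_congr rfl fun i _ => ?_
    rw [smulTree_child_L, smulTree_child_R]
    refine iht _ _ fun x => ?_
    unfold leafSum
    rw [Finset.smul_sum]
    refine Finset.sum_congr rfl fun ι _ => ?_
    refine Eq.trans (congrArg M ?_) (hM _)
    funext k
    refine Fin.addCases (fun k => ?_) (fun k => ?_) k
    · simp [Fin.append_left]
    · have := t.leaf_pos
      simp [Fin.append_right, this.ne']

/-- The multilinear map behind `projValue`. -/
noncomputable def projMul {n : ℕ} (α : Fin n → Bool) :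
    MultilinearMap K (fun _ : Fin n => V × K) (TensorAlgebra K V) :=
  (MultilinearMap.mkPiAlgebraFin K n (TensorAlgebra K V)).compLinearMap
    fun k => projTo K V (α k)

theorem projMul_apply {n : ℕ} (α : Fin n → Bool) (x : Fin n → V × K) :
    projMul α x = (List.ofFn fun k => projTo K V (α k) (x k)).prod := by
  simp [projMul]

theorem multilinear_zero {W : Type*} [AddCommMonoid W] [Module K W] {t : GradingTree}
    (M : MultilinearMap K (fun _ : Fin t.leaf => V × K) W) : M 0 = 0 :=
  M.map_coord_zero ⟨0, t.leaf_pos⟩ rfl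

theorem multilinear_add {W : Type*} [AddCommMonoid W] [Module K W]
    (M : MultilinearMap K (fun _ : Fin GradingTree.triv.leaf => V × K) W)
    (x y : Fin GradingTree.triv.leaf → V × K) : M (x + y) = M x + M y := by
  have key : ∀ z : Fin GradingTree.triv.leaf → V × K,
      Function.update (0 : Fin GradingTree.triv.leaf → V × K) ⟨0, Nat.one_pos⟩
        (z ⟨0, Nat.one_pos⟩) = z := by
    intro z
    funext k
    have : k = ⟨0, Nat.one_pos⟩ := Fin.ext (Nat.lt_one_iff.1 k.2)
    subst this
    simp
  rw [← key (x + y), Pi.add_apply, M.map_update_add, key, key]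

theorem multilinear_smul {W : Type*} [AddCommMonoid W] [Module K W] {t : GradingTree}
    (M : MultilinearMap K (fun _ : Fin t.leaf => V × K) W) (c : K) (x : Fin t.leaf → V × K) :
    M (fun k => if k.val = 0 then c • x k else x k) = c • M x := by
  have h : (fun k : Fin t.leaf => if k.val = 0 then c • x k else x k) =
      Function.update x ⟨0, t.leaf_pos⟩ (c • x ⟨0, t.leaf_pos⟩) := by
    funext k
    by_cases hk : k.val = 0
    · have : k = ⟨0, t.leaf_pos⟩ := Fin.ext hk
      subst this
      simp
    · have : k ≠ ⟨0, t.leaf_pos⟩ := fun h => hk (congrArg Fin.val h)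
      simp [hk, Function.update_of_ne this]
  rw [h, M.map_update_smul, Function.update_eq_self]

theorem projValue_eq (σ : GenTree K V) (t : GradingTree) (α : Fin t.leaf → Bool) :
    σ.projValue t α = σ.leafSum t (projMul α) := by
  simp only [projValue, leafSum, projMul_apply]

theorem treeValue_zero (t : GradingTree) : (zeroTree K V).treeValue t = 0 :=
  leafSum_zero t _ (multilinear_zero (PiTensorProduct.tprod K))

theorem treeValue_add (σ τ : GenTree K V) (t : GradingTree) :
    (addTree σ τ).treeValue t = σ.treeValue t + τ.treeValue t :=
  leafSum_add σ τ t _ (by rintro rfl; exact multilinear_add (PiTensorProduct.tprod K))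

theorem treeValue_smul (c : K) (σ : GenTree K V) (t : GradingTree) :
    (smulTree c σ).treeValue t = c • σ.treeValue t :=
  leafSum_smul c t σ _ (multilinear_smul (PiTensorProduct.tprod K) c)

theorem projValue_zero (t : GradingTree) (α : Fin t.leaf → Bool) :
    (zeroTree K V).projValue t α = 0 := by
  rw [projValue_eq]
  exact leafSum_zero t _ (multilinear_zero _)

theorem projValue_add (σ τ : GenTree K V) (t : GradingTree) (α : Fin t.leaf → Bool) :
    (addTree σ τ).projValue t α = σ.projValue t α + τ.projValue t α := by
  simp only [projValue_eq]
  exact leafSum_add σ τ t _ (by rintro rfl; exact multilinear_add _)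

theorem projValue_smul (c : K) (σ : GenTree K V) (t : GradingTree) (α : Fin t.leaf → Bool) :
    (smulTree c σ).projValue t α = c • σ.projValue t α := by
  simp only [projValue_eq]
  exact leafSum_smul c t σ _ (multilinear_smul _ c)

theorem normal_zero : (zeroTree K V).Normal := by
  intro s _ t u α β _
  change (zeroTree K V).projValue t α = (zeroTree K V).projValue u β
  rw [projValue_zero, projValue_zero]

theorem Normal.add {σ τ : GenTree K V} (hσ : σ.Normal) (hτ : τ.Normal) :
    (addTree σ τ).Normal := by
  rw [normal_iff] at hσ hτ ⊢
  refine ⟨fun t u α β h => ?_, fun d i hi => ?_⟩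
  · rw [projValue_add, projValue_add, hσ.1 t u α β h, hτ.1 t u α β h]
  · by_cases h : i < σ.rootWidth
    · rw [addTree_child_lt _ _ _ h]
      exact hσ.2 d i h
    · obtain ⟨j, rfl⟩ := Nat.exists_eq_add_of_le (not_lt.1 h)
      rw [addTree_child_add]
      exact hτ.2 d j (Nat.lt_of_add_lt_add_left hi)

theorem Normal.smul (c : K) {σ : GenTree K V} (hσ : σ.Normal) : (smulTree c σ).Normal := by
  intro s
  induction s generalizing σ with
  | nil =>
    intro _ t u α β h
    have hw : σ.WeaklyNormal := ((normal_iff σ).1 hσ).1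
    rw [subtree_nil, projValue_smul, projValue_smul, hw t u α β h]
  | cons p s ih =>
    obtain ⟨d, i⟩ := p
    intro hs
    have hi : i < σ.rootWidth := hs.1
    have hc := ((normal_iff σ).1 hσ).2 d i hi
    change (((smulTree c σ).child d i).subtree s).WeaklyNormal
    have hs2 : ((smulTree c σ).child d i).IsNode s := hs.2
    cases d with
    | L =>
      rw [smulTree_child_L] at hs2 ⊢
      exact ih hc hs2
    | R =>
      rw [smulTree_child_R] at hs2 ⊢
      exact hc s hs2

end Module

end GenTree

/-! ### The coalgebra of normal homomorphisms -/

section Nor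

variable (K : Type u) [CommRing K] (V : Type v) [AddCommGroup V] [Module K V]

/-- The module of normal homomorphisms: those generated by a normal generating tree. -/
def Nor : Submodule K (TreeHom K V) where
  carrier := {f | ∃ σ : GenTree K V, σ.Normal ∧ σ.Generates f}
  zero_mem' := ⟨GenTree.zeroTree K V, GenTree.normal_zero, fun t => by
    rw [GenTree.treeValue_zero, map_zero, LinearMap.zero_apply]⟩
  add_mem' := by
    rintro f g ⟨σ, hσ, hf⟩ ⟨τ, hτ, hg⟩
    exact ⟨GenTree.addTree σ τ, hσ.add hτ, fun t => by
      rw [GenTree.treeValue_add, map_add, LinearMap.add_apply, hf t, hg t]⟩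
  smul_mem' := by
    rintro c f ⟨σ, hσ, hf⟩
    exact ⟨GenTree.smulTree c σ, hσ.smul c, fun t => by
      rw [GenTree.treeValue_smul, map_smul, LinearMap.smul_apply, hf t]⟩

variable {K V}

/-- `f(join t u) = ∑_i g_i(t) * h_i(u)` for all grading trees `t`, `u`. -/
def TreeSplit {n : ℕ} (f : TreeHom K V) (g h : Fin n → TreeHom K V) : Prop :=
  ∀ t u : GradingTree,
    f.value (.join t u) = ∑ i, treeMul ((g i).value t) ((h i).value u)

/-- The coalgebra structure of `Nor K V`: the comultiplication takes `f` to `∑_i g_i ⊗ h_i`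
whenever `f(join t u) = ∑_i g_i(t) * h_i(u)` for all `t`, `u`, and such families exist for all `f`;
the counit is the `K`-component of `f(triv)`. There is at most one such structure. -/
structure IsNorCoalgebra (c : Coalgebra K (Nor K V)) : Prop where
  exists_split : ∀ f : Nor K V, ∃ (n : ℕ) (g h : Fin n → Nor K V),
    TreeSplit (f : TreeHom K V) (fun i => (g i : TreeHom K V)) (fun i => (h i : TreeHom K V))
  comul_eq : ∀ (f : Nor K V) (n : ℕ) (g h : Fin n → Nor K V),
    TreeSplit (f : TreeHom K V) (fun i => (g i : TreeHom K V)) (fun i => (h i : TreeHom K V)) →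
      c.comul f = ∑ i, g i ⊗ₜ[K] h i
  counit_eq : ∀ f : Nor K V, c.counit f = (f : TreeHom K V).rootValue.2

/-- The projection of `Nor K V` to `V`: the `V`-component of `f(triv)`. -/
noncomputable def norProj (f : Nor K V) : V := (f : TreeHom K V).rootValue.1

/-- The element that is the image of `X ^ n` under the map attached to `f`: the `K`-component of
`f(triv)` for `n = 0`, and `pr_V^{⊗ n}(f(t_n))` for `n ≥ 1`, with the left comb `t_n` with
`n` leaves. -/
noncomputable def combValue (f : TreeHom K V) : ℕ → TensorAlgebra K V
  | 0 => algebraMap K (TensorAlgebra K V) f.rootValue.2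
  | n + 1 => TensorPower.toTensorAlgebra
      (PiTensorProduct.map (fun _ => LinearMap.fst K V K) (f.value (GradingTree.comb n)))

end Nor

/-! ### The Block–Leroux coalgebra -/

section BlockLeroux

variable {K : Type u} [CommRing K] {V : Type v} [AddCommGroup V] [Module K V]

/-- `f` preserves degrees. -/
def PreservesDegree (f : K[X] →ₗ[K] TensorAlgebra K V) : Prop :=
  ∀ n : ℕ, f (Polynomial.X ^ n) ∈ LinearMap.range (TensorAlgebra.ι K (M := V)) ^ n

/-- `f(p q) = ∑_i g_i(p) h_i(q)` for all polynomials `p`, `q`. -/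
def PolySplit {n : ℕ} (f : K[X] →ₗ[K] TensorAlgebra K V)
    (g h : Fin n → (K[X] →ₗ[K] TensorAlgebra K V)) : Prop :=
  ∀ p q : K[X], f (p * q) = ∑ i, g i p * h i q

variable (K V)

/-- The module of linear maps `K[X] → TV` that are representative in the sense of Block and
Leroux. -/
def BLRep : Submodule K (K[X] →ₗ[K] TensorAlgebra K V) where
  carrier := {f | PreservesDegree f ∧
    ∃ (n : ℕ) (g h : Fin n → (K[X] →ₗ[K] TensorAlgebra K V)), PolySplit f g h}
  zero_mem' := ⟨fun _ => zero_mem _, 0, 0, 0, fun _ _ => by simp⟩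
  add_mem' := by
    rintro f f2 ⟨hf, n, g, h, H⟩ ⟨hf2, n2, g2, h2, H2⟩
    refine ⟨fun k => add_mem (hf k) (hf2 k), n + n2, Fin.append g g2, Fin.append h h2,
      fun p q => ?_⟩
    simp [Fin.sum_univ_add, H p q, H2 p q]
  smul_mem' := by
    rintro c f ⟨hf, n, g, h, H⟩
    exact ⟨fun k => Submodule.smul_mem _ c (hf k), n, fun i => c • g i, h, fun p q => by
      simp [H p q, Finset.smul_sum]⟩

variable {K V}

/-- The coalgebra structure of `BLRep K V`: the comultiplication takes `f` to `∑_i g_i ⊗ h_i`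
whenever `f(p q) = ∑_i g_i(p) h_i(q)` for all `p`, `q`, and such families in `BLRep K V` exist for
all `f`; the counit is `f(1)`, an element of the degree-zero part `K` of `TV`. There is at most
one such structure. -/
structure IsBLCoalgebra (c : Coalgebra K (BLRep K V)) : Prop where
  exists_split : ∀ f : BLRep K V, ∃ (n : ℕ) (g h : Fin n → BLRep K V),
    PolySplit (f : K[X] →ₗ[K] TensorAlgebra K V) (fun i => (g i).1) (fun i => (h i).1)
  comul_eq : ∀ (f : BLRep K V) (n : ℕ) (g h : Fin n → BLRep K V),
    PolySplit (f : K[X] →ₗ[K] TensorAlgebra K V) (fun i => (g i).1) (fun i => (h i).1) →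
      c.comul f = ∑ i, g i ⊗ₜ[K] h i
  counit_eq : ∀ f : BLRep K V, algebraMap K (TensorAlgebra K V) (c.counit f) = f.1 1

/-- The projection of `BLRep K V` to `V`: the value `f(X)`, an element of the degree-one part `V`
of `TV`. -/
noncomputable def blProj (f : BLRep K V) : V := TensorAlgebra.ιInv (f.1 Polynomial.X)

/-- `f(X)` indeed is the element `blProj f` of `V`. -/
theorem ι_blProj (f : BLRep K V) : TensorAlgebra.ι K (blProj f) = f.1 Polynomial.X := by
  have h := f.2.1 1
  rw [pow_one, pow_one] at h
  obtain ⟨v, hv⟩ := h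
  rw [blProj, ← hv, TensorAlgebra.ι_leftInverse v]

end BlockLeroux

/-!
Fix a basis of `V`. A degree-preserving `f : K[X] → TV` is determined by its word coefficients, and
a splitting of `f` into degree-preserving maps is a factorization of its coefficient matrix
`(u, w) ↦ wordCoef b (u * w) f` through a finite-dimensional space. The point is that a splitting
into *arbitrary* linear maps already bounds the rank of this matrix. Compose `f` with the action of
`TV` by weighted shifts on sequences of length `N`, the weights being indeterminates: counting
unknowns as `N` grows, a splitting with `r` summands makes all minors of size `r + 1` vanish in the
matrix of the weighted values `f (X ^ (m + n))`. Expand along a nonzero minor of maximal size, and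
specialize the weights so that they single out a word `u` far to the left and a word `w` far to the
right. This shows that a combination of rows, or of columns, of the coefficient matrix vanishes as
soon as it vanishes on all short words. Only finitely many short words matter, so the rank is finite
and `f` splits into combinations of its one-sided translates, which are representative again. Now
`BL(V)` is a space of functions on the monoid of words that is closed under splitting, hence a
coalgebra.

For a normal tree `σ` the value `σ⟨t | α⟩` depends on `deg α` only. The homomorphism it generates is
therefore determined by its values at combs, which form a representative map, since the children of
the root split it. Conversely the tree of iterated splittings of a representative map is normal.
-/

/-! ### Words in a basis -/

section Words

open Polynomial (X)

variable {K : Type u} [CommRing K] {V : Type v} [AddCommGroup V] [Module K V]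
variable {β : Type*} (b : Module.Basis β K V)

theorem tensorAlgebra_basis_one : b.tensorAlgebra 1 = 1 := by
  simp [Module.Basis.tensorAlgebra, FreeAlgebra.basisFreeMonoid, ← MonoidAlgebra.one_def]

theorem tensorAlgebra_basis_mul (u w : FreeMonoid β) :
    b.tensorAlgebra (u * w) = b.tensorAlgebra u * b.tensorAlgebra w := by
  simp [Module.Basis.tensorAlgebra, FreeAlgebra.basisFreeMonoid, ← map_mul]

theorem tensorAlgebra_basis_of (x : β) :
    b.tensorAlgebra (FreeMonoid.of x) = TensorAlgebra.ι K (b x) := by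
  simp [Module.Basis.tensorAlgebra, FreeAlgebra.basisFreeMonoid,
    FreeAlgebra.equivMonoidAlgebraFreeMonoid]

theorem range_ι_eq_span :
    LinearMap.range (TensorAlgebra.ι K (M := V)) =
      Submodule.span K (Set.range fun x => TensorAlgebra.ι K (b x)) := by
  rw [LinearMap.range_eq_map, ← b.span_eq, Submodule.map_span, ← Set.range_comp]
  rfl

theorem range_ι_pow_eq_span (n : ℕ) :
    LinearMap.range (TensorAlgebra.ι K (M := V)) ^ n =
      Submodule.span K (b.tensorAlgebra '' {w | w.length = n}) := by
  induction n with
  | zero => simp [FreeMonoid.length_eq_zero, tensorAlgebra_basis_one, Submodule.one_eq_span]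
  | succ n ih =>
    rw [pow_succ', ih, range_ι_eq_span b, Submodule.span_mul_span]
    congr 1
    ext x
    constructor
    · rintro ⟨_, ⟨y, rfl⟩, _, ⟨w, rfl, rfl⟩, rfl⟩
      exact ⟨FreeMonoid.of y * w, by simp [FreeMonoid.length_mul, add_comm],
        by rw [tensorAlgebra_basis_mul, tensorAlgebra_basis_of]⟩
    · rintro ⟨w, hw, rfl⟩
      induction w using FreeMonoid.casesOn with
      | one => simp at hw
      | of_mul y w =>
        refine ⟨_, ⟨y, rfl⟩, _, ⟨w, ?_, rfl⟩, ?_⟩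
        · simpa [FreeMonoid.length_mul, add_comm] using hw
        · rw [tensorAlgebra_basis_mul, tensorAlgebra_basis_of]

theorem mem_range_ι_pow_iff {n : ℕ} {x : TensorAlgebra K V} :
    x ∈ LinearMap.range (TensorAlgebra.ι K (M := V)) ^ n ↔
      ∀ w : FreeMonoid β, w.length ≠ n → b.tensorAlgebra.coord w x = 0 := by
  rw [range_ι_pow_eq_span b, b.tensorAlgebra.mem_span_image]
  simp only [Set.subset_def, Finset.mem_coe, Finsupp.mem_support_iff, Set.mem_ofPred_eq,
    Module.Basis.coord_apply, not_imp_comm, ne_eq]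

theorem eq_of_mem_range_ι_pow {M : Type*} [AddCommGroup M] [Module K M]
    {φ ψ : TensorAlgebra K V →ₗ[K] M} {n : ℕ}
    (h : ∀ w : FreeMonoid β, w.length = n → φ (b.tensorAlgebra w) = ψ (b.tensorAlgebra w))
    {x : TensorAlgebra K V} (hx : x ∈ LinearMap.range (TensorAlgebra.ι K (M := V)) ^ n) :
    φ x = ψ x := by
  rw [range_ι_pow_eq_span b] at hx
  exact LinearMap.eqOn_span (by rintro _ ⟨w, hw, rfl⟩; exact h w hw) hx

theorem ext_of_mem_range_ι_pow {n : ℕ} {x y : TensorAlgebra K V}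
    (hx : x ∈ LinearMap.range (TensorAlgebra.ι K (M := V)) ^ n)
    (hy : y ∈ LinearMap.range (TensorAlgebra.ι K (M := V)) ^ n)
    (h : ∀ w : FreeMonoid β, w.length = n →
      b.tensorAlgebra.coord w x = b.tensorAlgebra.coord w y) : x = y := by
  refine b.tensorAlgebra.ext_elem fun w => ?_
  by_cases hw : w.length = n
  · exact h w hw
  · exact ((mem_range_ι_pow_iff b).1 hx w hw).trans ((mem_range_ι_pow_iff b).1 hy w hw).symm

theorem coord_word_mul_word {u u' : FreeMonoid β} (hu : u'.length = u.length)
    (w w' : FreeMonoid β) :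
    b.tensorAlgebra.coord (u * w) (b.tensorAlgebra u' * b.tensorAlgebra w') =
      b.tensorAlgebra.coord u (b.tensorAlgebra u') *
        b.tensorAlgebra.coord w (b.tensorAlgebra w') := by
  have mul_eq_mul : u' * w' = u * w ↔ u' = u ∧ w' = w :=
    ⟨fun h => List.append_inj h hu, fun h => by rw [h.1, h.2]⟩
  rw [← tensorAlgebra_basis_mul]
  by_cases h₁ : u' = u <;> by_cases h₂ : w' = w <;> simp [mul_eq_mul, h₁, h₂]

theorem coord_mul_of_mem_range_ι_pow {x : TensorAlgebra K V} {u : FreeMonoid β}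
    (hx : x ∈ LinearMap.range (TensorAlgebra.ι K (M := V)) ^ u.length) (w : FreeMonoid β)
    (y : TensorAlgebra K V) :
    b.tensorAlgebra.coord (u * w) (x * y) =
      b.tensorAlgebra.coord u x * b.tensorAlgebra.coord w y := by
  suffices h : b.tensorAlgebra.coord (u * w) ∘ₗ LinearMap.mulLeft K x =
      b.tensorAlgebra.coord u x • b.tensorAlgebra.coord w from LinearMap.congr_fun h y
  refine b.tensorAlgebra.ext fun w' => ?_
  exact eq_of_mem_range_ι_pow b
    (φ := b.tensorAlgebra.coord (u * w) ∘ₗ LinearMap.mulRight K (b.tensorAlgebra w'))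
    (ψ := LinearMap.mulRight K (b.tensorAlgebra.coord w (b.tensorAlgebra w')) ∘ₗ
      b.tensorAlgebra.coord u) (fun u' hu => coord_word_mul_word b hu w w') hx

/-- The coefficient at the word `w` of the value of `f` at the power of `X` of the same length.
The coefficients at all words determine a degree-preserving `f`. -/
noncomputable def wordCoef (w : FreeMonoid β) : (K[X] →ₗ[K] TensorAlgebra K V) →ₗ[K] K :=
  b.tensorAlgebra.coord w ∘ₗ LinearMap.applyₗ (X ^ w.length)

theorem wordCoef_apply (w : FreeMonoid β) (f : K[X] →ₗ[K] TensorAlgebra K V) :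
    wordCoef b w f = b.tensorAlgebra.coord w (f (X ^ w.length)) := rfl

theorem algebraMap_wordCoef_one {f : K[X] →ₗ[K] TensorAlgebra K V} (hf : PreservesDegree f) :
    algebraMap K (TensorAlgebra K V) (wordCoef b 1 f) = f 1 := by
  obtain ⟨c, hc⟩ : ∃ c, algebraMap K (TensorAlgebra K V) c = f 1 := by
    simpa [Submodule.mem_one] using hf 0
  rw [wordCoef_apply, FreeMonoid.length_one, pow_zero, ← hc]
  simp [Algebra.algebraMap_eq_smul_one, ← tensorAlgebra_basis_one b]

theorem PreservesDegree.ext {f g : K[X] →ₗ[K] TensorAlgebra K V} (hf : PreservesDegree f)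
    (hg : PreservesDegree g) (h : ∀ w, wordCoef b w f = wordCoef b w g) : f = g := by
  refine Polynomial.lhom_ext' fun n => LinearMap.ext_ring ?_
  have apply_X_pow : f (X ^ n) = g (X ^ n) :=
    ext_of_mem_range_ι_pow b (hf n) (hg n) (by rintro w rfl; exact h w)
  simpa [← Polynomial.X_pow_eq_monomial] using apply_X_pow

theorem PolySplit.of_pow {n : ℕ} {f : K[X] →ₗ[K] TensorAlgebra K V}
    {g h : Fin n → (K[X] →ₗ[K] TensorAlgebra K V)}
    (H : ∀ k l : ℕ, f (X ^ (k + l)) = ∑ i, g i (X ^ k) * h i (X ^ l)) : PolySplit f g h := by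
  intro p q
  induction p using Polynomial.induction_on' with
  | add p p' hp hp' => simp only [add_mul, map_add, hp, hp', Finset.sum_add_distrib]
  | monomial k c =>
    induction q using Polynomial.induction_on' with
    | add q q' hq hq' => simp only [mul_add, map_add, hq, hq', Finset.sum_add_distrib]
    | monomial l d =>
      rw [Polynomial.monomial_mul_monomial, ← Polynomial.smul_X_eq_monomial,
        ← Polynomial.smul_X_eq_monomial, ← Polynomial.smul_X_eq_monomial]
      simp only [map_smul, H, smul_mul_smul_comm, Finset.smul_sum]

theorem exists_eq_mul_of_length_eq_add {w : FreeMonoid β} {k l : ℕ} (hw : w.length = k + l) :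
    ∃ u v : FreeMonoid β, w = u * v ∧ u.length = k ∧ v.length = l := by
  replace hw : w.toList.length = k + l := hw
  have length_take : (w.toList.take k).length = k := by simp [hw]
  have length_drop : (w.toList.drop k).length = l := by simp [hw]
  exact ⟨FreeMonoid.ofList (w.toList.take k), FreeMonoid.ofList (w.toList.drop k),
    (List.take_append_drop k w.toList).symm, length_take, length_drop⟩

theorem polySplit_iff_wordCoef {n : ℕ} {f : K[X] →ₗ[K] TensorAlgebra K V}
    {g h : Fin n → (K[X] →ₗ[K] TensorAlgebra K V)} (hf : PreservesDegree f)
    (hg : ∀ i, PreservesDegree (g i)) (hh : ∀ i, PreservesDegree (h i)) :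
    PolySplit f g h ↔ ∀ u w : FreeMonoid β,
      wordCoef b (u * w) f = ∑ i, wordCoef b u (g i) * wordCoef b w (h i) := by
  have coord_sum (u w : FreeMonoid β) :
      b.tensorAlgebra.coord (u * w) (∑ i, g i (X ^ u.length) * h i (X ^ w.length)) =
        ∑ i, wordCoef b u (g i) * wordCoef b w (h i) := by
    rw [map_sum]
    exact Finset.sum_congr rfl fun i _ => coord_mul_of_mem_range_ι_pow b (hg i _) _ _
  constructor
  · intro H u w
    rw [wordCoef_apply, FreeMonoid.length_mul, pow_add, H, coord_sum]
  · intro H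
    refine PolySplit.of_pow fun k l => ext_of_mem_range_ι_pow b (hf _) ?_ fun w hw => ?_
    · rw [pow_add]
      exact Submodule.sum_mem _ fun i _ => Submodule.mul_mem_mul (hg i k) (hh i l)
    · obtain ⟨u, v, rfl, rfl, rfl⟩ := exists_eq_mul_of_length_eq_add hw
      rw [coord_sum, ← H, wordCoef_apply, FreeMonoid.length_mul]

/-- Deletes the prefix `u` and the suffix `w` from every word of the form `u * v * w`, and kills
all other words. -/
noncomputable def contract (u w : FreeMonoid β) : TensorAlgebra K V →ₗ[K] TensorAlgebra K V :=
  b.tensorAlgebra.repr.symm.toLinearMap ∘ₗ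
    Finsupp.lcomapDomain (fun v => u * v * w)
      (fun _ _ h => mul_left_cancel (mul_right_cancel h)) ∘ₗ
    b.tensorAlgebra.repr.toLinearMap

theorem coord_contract (u v w : FreeMonoid β) (x : TensorAlgebra K V) :
    b.tensorAlgebra.coord v (contract b u w x) = b.tensorAlgebra.coord (u * v * w) x := by
  simp only [contract, Module.Basis.coord_apply, LinearMap.comp_apply, LinearEquiv.coe_coe,
    Module.Basis.repr_symm_apply, Module.Basis.repr_linearCombination]
  rfl

/-- The two-sided translate of `f` by the words `u` and `w`, whose coefficient at `v` is the
coefficient of `f` at `u * v * w`. -/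
noncomputable def wordTranslate (u w : FreeMonoid β) :
    (K[X] →ₗ[K] TensorAlgebra K V) →ₗ[K] (K[X] →ₗ[K] TensorAlgebra K V) :=
  (contract b u w).compRight K ∘ₗ
    LinearMap.lcomp K _ (LinearMap.mulLeft K (X ^ (u.length + w.length)))

theorem wordTranslate_apply_X_pow (u w : FreeMonoid β) (f : K[X] →ₗ[K] TensorAlgebra K V) (n : ℕ) :
    wordTranslate b u w f (X ^ n) = contract b u w (f (X ^ (u.length + n + w.length))) := by
  simp [wordTranslate, ← pow_add, add_right_comm]

@[simp]
theorem wordCoef_wordTranslate (u v w : FreeMonoid β) (f : K[X] →ₗ[K] TensorAlgebra K V) :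
    wordCoef b v (wordTranslate b u w f) = wordCoef b (u * v * w) f := by
  rw [wordCoef_apply, wordCoef_apply, wordTranslate_apply_X_pow, coord_contract,
    FreeMonoid.length_mul, FreeMonoid.length_mul]

theorem PreservesDegree.wordTranslate {f : K[X] →ₗ[K] TensorAlgebra K V} (hf : PreservesDegree f)
    (u w : FreeMonoid β) : PreservesDegree (wordTranslate b u w f) := by
  intro n
  refine (mem_range_ι_pow_iff b).2 fun v hv => ?_
  rw [wordTranslate_apply_X_pow, coord_contract]
  refine (mem_range_ι_pow_iff b).1 (hf _) _ ?_
  rw [FreeMonoid.length_mul, FreeMonoid.length_mul]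
  omega

theorem wordTranslate_wordTranslate (u u' w w' : FreeMonoid β)
    (f : K[X] →ₗ[K] TensorAlgebra K V) :
    wordTranslate b u w (wordTranslate b u' w' f) = wordTranslate b (u' * u) (w * w') f := by
  refine Polynomial.lhom_ext' fun n => LinearMap.ext_ring (b.tensorAlgebra.ext_elem fun v => ?_)
  have exponent : u'.length + (u.length + n + w.length) + w'.length =
      u'.length + u.length + n + (w.length + w'.length) := by ring
  simp only [LinearMap.comp_apply, ← Polynomial.X_pow_eq_monomial, wordTranslate_apply_X_pow]
  simp only [← Module.Basis.coord_apply, coord_contract, FreeMonoid.length_mul, mul_assoc,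
    exponent]

end Words

/-! ### Minors and rank -/

section Minors

open Matrix

variable {R : Type*} [CommRing R] {ι κ : Type*}

theorem exists_mulVec_eq_zero_of_card_lt [Nontrivial R] [Fintype ι] [Fintype κ]
    (A : Matrix ι κ R) (h : Fintype.card ι < Fintype.card κ) :
    ∃ y ≠ 0, A *ᵥ y = 0 := by
  by_contra! injective
  exact h.not_ge <| card_le_of_injective R A.mulVecLin <|
    (injective_iff_map_eq_zero _).2 fun y hy => by_contra fun hy0 => injective y hy0 hy

theorem exists_maximal_minor [Nontrivial R] {M : Matrix ι κ R} {r : ℕ}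
    (h : ∀ (k : Fin (r + 1) → ι) (l : Fin (r + 1) → κ), (M.submatrix k l).det = 0) :
    ∃ (p : ℕ) (k : Fin p → ι) (l : Fin p → κ), (M.submatrix k l).det ≠ 0 ∧
      ∀ (k' : Fin (p + 1) → ι) (l' : Fin (p + 1) → κ), (M.submatrix k' l').det = 0 := by
  by_contra! extend
  have exists_minor (p : ℕ) :
      ∃ (k : Fin p → ι) (l : Fin p → κ), (M.submatrix k l).det ≠ 0 := by
    induction p with
    | zero => exact ⟨Fin.elim0, Fin.elim0, by simp⟩
    | succ p ih =>
      obtain ⟨k, l, hkl⟩ := ih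
      exact extend p k l hkl
  obtain ⟨k, l, hkl⟩ := exists_minor (r + 1)
  exact hkl (h k l)

theorem det_mul_eq_of_det_fromBlocks_eq_zero [IsDomain R] {m n : Type*} [Fintype m]
    [DecidableEq m] [Fintype n] [DecidableEq n] [Unique n] {A : Matrix m m R} {B : Matrix m n R}
    {C : Matrix n m R} {D : Matrix n n R} (hA : A.det ≠ 0)
    (h : (fromBlocks A B C D).det = 0) :
    A.det • D = C * A.adjugate * B := by
  have triangular : fromBlocks A B C D * fromBlocks A.adjugate (-(A.adjugate * B)) 0 (A.det • 1) =
      fromBlocks (A.det • 1) 0 (C * A.adjugate) (A.det • D - C * A.adjugate * B) := by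
    rw [fromBlocks_multiply]
    congr 1
    · rw [mul_adjugate, Matrix.mul_zero, add_zero]
    · rw [Matrix.mul_neg, ← Matrix.mul_assoc, mul_adjugate, Matrix.smul_mul, Matrix.one_mul,
        Matrix.mul_smul, Matrix.mul_one, neg_add_cancel]
    · rw [Matrix.mul_zero, add_zero]
    · rw [Matrix.mul_neg, ← Matrix.mul_assoc, Matrix.mul_smul, Matrix.mul_one, neg_add_eq_sub]
  have det_eq := congrArg det triangular
  rw [det_mul, h, zero_mul, det_fromBlocks_zero₁₂, det_smul, det_one, mul_one, eq_comm,
    mul_eq_zero_iff_left (pow_ne_zero _ hA), det_unique] at det_eq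
  ext i j
  rw [Subsingleton.elim i default, Subsingleton.elim j default]
  exact sub_eq_zero.1 det_eq

theorem det_submatrix_mul_eq [IsDomain R] {p : ℕ} {M : Matrix ι κ R} {k : Fin p → ι}
    {l : Fin p → κ} (hdet : (M.submatrix k l).det ≠ 0)
    (h : ∀ (k' : Fin (p + 1) → ι) (l' : Fin (p + 1) → κ), (M.submatrix k' l').det = 0)
    (x : ι) (y : κ) :
    (M.submatrix k l).det * M x y =
      ∑ j, (∑ i, M x (l i) * (M.submatrix k l).adjugate i j) * M (k j) y := by
  have blocks : fromBlocks (M.submatrix k l) (M.submatrix k fun _ : Fin 1 => y)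
      (M.submatrix (fun _ : Fin 1 => x) l) (M.submatrix (fun _ : Fin 1 => x) fun _ => y) =
      (M.submatrix (Fin.append k fun _ => x) (Fin.append l fun _ => y)).submatrix
        finSumFinEquiv finSumFinEquiv := by
    ext (i | i) (j | j) <;> simp
  have key := det_mul_eq_of_det_fromBlocks_eq_zero hdet
    (by rw [blocks, det_submatrix_equiv_self, h])
  exact congrFun (congrFun key 0) 0

end Minors

/-! ### Weighted shifts -/

section Weights

open Polynomial (X)

variable {R : Type*} [CommRing R] {β : Type*}

/-- The product of the weights of the letters of a word that is written from the place `i` on. -/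
def wordWeight (s : ℤ → β → R) : ℤ → List β → R
  | _, [] => 1
  | i, x :: w => s i x * wordWeight s (i + 1) w

theorem wordWeight_append (s : ℤ → β → R) (i : ℤ) (u w : List β) :
    wordWeight s i (u ++ w) = wordWeight s i u * wordWeight s (i + u.length) w := by
  induction u generalizing i with
  | nil => simp [wordWeight]
  | cons x u ih =>
    simp only [List.cons_append, wordWeight, ih, mul_assoc, List.length_cons]
    congr 3
    push_cast
    ring

theorem wordWeight_congr {s s' : ℤ → β → R} {i : ℤ} {w : List β}
    (h : ∀ j x, i ≤ j → j < i + w.length → s j x = s' j x) :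
    wordWeight s i w = wordWeight s' i w := by
  induction w generalizing i with
  | nil => rfl
  | cons x w ih =>
    rw [List.length_cons] at h
    rw [wordWeight, wordWeight, h i x le_rfl (by omega),
      ih fun j y hj hj' => h j y (by omega) (by omega)]

theorem map_wordWeight {R' : Type*} [CommRing R'] (η : R →+* R') (s : ℤ → β → R) (i : ℤ)
    (w : List β) : η (wordWeight s i w) = wordWeight (fun j x => η (s j x)) i w := by
  induction w generalizing i with
  | nil => exact map_one η
  | cons x w ih => rw [wordWeight, wordWeight, map_mul, ih]

theorem wordWeight_shift (s : ℤ → β → R) (i j : ℤ) (w : List β) :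
    wordWeight (fun k => s (k + j)) i w = wordWeight s (i + j) w := by
  induction w generalizing i with
  | nil => rfl
  | cons x w ih => rw [wordWeight, wordWeight, ih, add_right_comm]

open Classical in
/-- The weights that single out the word `w` written from the place `i` on, see
`wordWeight_indicatorWeight`. Only the places from `i` to `i + w.length - 1` matter. -/
noncomputable def indicatorWeight (R : Type*) [CommRing R] (i : ℤ) (w : List β) (j : ℤ) (x : β) :
    R :=
  if w[(j - i).toNat]? = some x then 1 else 0

theorem indicatorWeight_cons {i j : ℤ} (h : i < j) (y x : β) (w : List β) :
    indicatorWeight R i (y :: w) j x = indicatorWeight R (i + 1) w j x := by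
  have toNat_sub : (j - i).toNat = (j - (i + 1)).toNat + 1 := by omega
  rw [indicatorWeight, indicatorWeight, toNat_sub, List.getElem?_cons_succ]

open Classical in
theorem wordWeight_indicatorWeight (i : ℤ) {u w : List β} (hu : u.length = w.length) :
    wordWeight (indicatorWeight R i w) i u = if u = w then 1 else 0 := by
  induction u generalizing i w with
  | nil => simp [wordWeight, List.eq_nil_of_length_eq_zero hu.symm]
  | cons x u ih =>
    obtain _ | ⟨y, w⟩ := w
    · simp at hu
    have tail : wordWeight (indicatorWeight R i (y :: w)) (i + 1) u = if u = w then 1 else 0 := by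
      rw [← ih (i + 1) (by simpa using hu)]
      exact wordWeight_congr fun j z hj _ => indicatorWeight_cons (by omega) y z w
    rw [wordWeight, tail]
    by_cases hxy : y = x <;> by_cases huw : u = w <;> simp [indicatorWeight, hxy, huw, Ne.symm]

open Classical in
theorem wordWeight_append_append {s s' : ℤ → β → R} {i : ℤ} {u u' v w w' : List β}
    (hu' : u'.length = u.length) (hw' : w'.length = w.length)
    (hu : ∀ j x, i ≤ j → j < i + u.length → s j x = indicatorWeight R i u j x)
    (hv : ∀ j x, i + u.length ≤ j → j < i + u.length + v.length → s j x = s' j x)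
    (hw : ∀ j x, i + u.length + v.length ≤ j → j < i + u.length + v.length + w.length →
      s j x = indicatorWeight R (i + u.length + v.length) w j x) :
    wordWeight s i (u' ++ v ++ w') =
      if u' = u ∧ w' = w then wordWeight s' (i + u.length) v else 0 := by
  rw [← hu'] at hu
  rw [← hw'] at hw
  rw [wordWeight_append, wordWeight_append, List.length_append, Nat.cast_add, ← add_assoc,
    wordWeight_congr hu, hu', wordWeight_congr hv, wordWeight_congr hw,
    wordWeight_indicatorWeight i hu', wordWeight_indicatorWeight _ hw']
  by_cases h₁ : u' = u <;> by_cases h₂ : w' = w <;> simp [h₁, h₂]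

variable {K : Type u} [CommRing K] {V : Type v} [AddCommGroup V] [Module K V]
  (b : Module.Basis β K V) [Algebra K R]

/-- The linear extension of `wordWeight` to the tensor algebra. -/
noncomputable def weightMap (s : ℤ → β → R) (i : ℤ) : TensorAlgebra K V →ₗ[K] R :=
  b.tensorAlgebra.constr K fun w => wordWeight s i w.toList

theorem weightMap_basis (s : ℤ → β → R) (i : ℤ) (w : FreeMonoid β) :
    weightMap b s i (b.tensorAlgebra w) = wordWeight s i w.toList :=
  b.tensorAlgebra.constr_basis K _ w

theorem map_weightMap {R' : Type*} [CommRing R'] [Algebra K R'] (η : R →ₐ[K] R')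
    (s : ℤ → β → R) (i : ℤ) (a : TensorAlgebra K V) :
    η (weightMap b s i a) = weightMap b (fun j x => η (s j x)) i a := by
  suffices h : η.toLinearMap ∘ₗ weightMap b s i = weightMap b (fun j x => η (s j x)) i from
    LinearMap.congr_fun h a
  refine b.tensorAlgebra.ext fun w => ?_
  rw [LinearMap.comp_apply, weightMap_basis, weightMap_basis]
  exact map_wordWeight (η : R →+* R') s i w.toList

theorem weightMap_shift (s : ℤ → β → R) (i j : ℤ) :
    weightMap b (fun k => s (k + j)) i = weightMap b s (i + j) := by
  refine b.tensorAlgebra.ext fun w => ?_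
  rw [weightMap_basis, weightMap_basis, wordWeight_shift]

theorem weightMap_indicatorWeight (i : ℤ) {w : FreeMonoid β} {a : TensorAlgebra K V}
    (ha : a ∈ LinearMap.range (TensorAlgebra.ι K (M := V)) ^ w.length) :
    weightMap b (indicatorWeight K i w.toList) i a = b.tensorAlgebra.coord w a := by
  classical
  refine eq_of_mem_range_ι_pow b (fun u hu => ?_) ha
  rw [weightMap_basis, wordWeight_indicatorWeight i hu, Module.Basis.coord_apply,
    Module.Basis.repr_self, Finsupp.single_apply]
  exact if_congr FreeMonoid.toList.injective.eq_iff rfl rfl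

/-- The tensor algebra acts on the sequences of length `N` by weighted shifts: the letter `x` takes
`y` to the sequence `i ↦ s i x * y (i + 1)`. -/
noncomputable def shiftRep (s : ℤ → β → R) (N : ℕ) :
    TensorAlgebra K V →ₐ[K] Matrix (Fin N) (Fin N) R :=
  TensorAlgebra.lift K <| b.constr K fun x =>
    Matrix.of fun i j => if (j : ℕ) = i + 1 then s i x else 0

theorem shiftRep_ι (s : ℤ → β → R) {N : ℕ} (x : β) (i j : Fin N) :
    shiftRep b s N (TensorAlgebra.ι K (b x)) i j = if (j : ℕ) = i + 1 then s i x else 0 := by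
  rw [shiftRep, TensorAlgebra.lift_ι_apply, Module.Basis.constr_basis, Matrix.of_apply]

theorem shiftRep_basis (s : ℤ → β → R) {N : ℕ} (w : FreeMonoid β) (i j : Fin N) :
    shiftRep b s N (b.tensorAlgebra w) i j =
      if (j : ℕ) = i + w.length then wordWeight s i w.toList else 0 := by
  induction w using FreeMonoid.inductionOn' generalizing i with
  | one =>
    rw [tensorAlgebra_basis_one, map_one, Matrix.one_apply]
    simp [wordWeight, Fin.ext_iff, eq_comm]
  | of_mul x w ih =>
    rw [tensorAlgebra_basis_mul, map_mul, tensorAlgebra_basis_of, Matrix.mul_apply,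
      FreeMonoid.length_mul, FreeMonoid.length_of, FreeMonoid.toList_of_mul, wordWeight]
    simp only [shiftRep_ι, ih, ite_mul, zero_mul]
    by_cases hi : (i : ℕ) + 1 < N
    · rw [Finset.sum_eq_single ⟨i + 1, hi⟩]
      · simp [add_assoc]
      · exact fun k _ hk => if_neg fun h => hk (Fin.ext h)
      · simp
    · rw [Finset.sum_eq_zero fun k _ => if_neg (by omega), if_neg (by omega)]

theorem shiftRep_apply (s : ℤ → β → R) {N n : ℕ} {a : TensorAlgebra K V}
    (ha : a ∈ LinearMap.range (TensorAlgebra.ι K (M := V)) ^ n) (i j : Fin N) :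
    shiftRep b s N a i j = if (j : ℕ) = i + n then weightMap b s i a else 0 := by
  refine (eq_of_mem_range_ι_pow b
    (φ := Matrix.entryLinearMap K R i j ∘ₗ (shiftRep b s N).toLinearMap)
    (ψ := (if (j : ℕ) = i + n then (1 : K) else 0) • weightMap b s i)
    (fun w hw => ?_) ha).trans ?_
  · subst hw
    by_cases hj : (j : ℕ) = i + w.length <;> simp [hj, shiftRep_basis, weightMap_basis]
  · split_ifs <;> simp

end Weights

/-! ### Hankel matrices -/

section Hankel

open Polynomial (X)
open Matrix

variable {K : Type u} [CommRing K] {V : Type v} [AddCommGroup V] [Module K V]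
  {β : Type*} (b : Module.Basis β K V) {R : Type*} [CommRing R] [Algebra K R]

theorem PolySplit.exists_mulVec_relation [Nontrivial R] {μ ι : Type*} [Fintype μ] [DecidableEq μ]
    [Fintype ι] {r : ℕ} {f : K[X] →ₗ[K] TensorAlgebra K V}
    {g h : Fin r → (K[X] →ₗ[K] TensorAlgebra K V)} (H : PolySplit f g h)
    (ρ : TensorAlgebra K V →ₐ[K] Matrix μ μ R) (q : ι → K[X]) (c : ι → μ)
    (hcard : r * Fintype.card μ < Fintype.card ι) :
    ∃ y : ι → R, y ≠ 0 ∧ ∀ p i, ∑ j, ρ (f (p * q j)) i (c j) * y j = 0 := by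
  let A : Matrix (Fin r × μ) ι R := Matrix.of fun k j => ρ (h k.1 (q j)) k.2 (c j)
  obtain ⟨y, hy, hAy⟩ := exists_mulVec_eq_zero_of_card_lt A (by simpa using hcard)
  refine ⟨y, hy, fun p i => ?_⟩
  calc ∑ j, ρ (f (p * q j)) i (c j) * y j
    _ = ∑ j, ∑ k : Fin r × μ, ρ (g k.1 p) i k.2 * (A k j * y j) := by
      refine Finset.sum_congr rfl fun j _ => ?_
      simp only [H p, map_sum, map_mul, Matrix.sum_apply, Matrix.mul_apply, Finset.sum_mul,
        Fintype.sum_prod_type, A, Matrix.of_apply, mul_assoc]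
    _ = ∑ k : Fin r × μ, ρ (g k.1 p) i k.2 * (A *ᵥ y) k := by
      rw [Finset.sum_comm]
      simp only [← Finset.mul_sum, Matrix.mulVec, dotProduct]
    _ = 0 := by simp [hAy]

-- There are `N * (r + 1) = r * M + 1` unknowns for `r * M` equations.
theorem exists_det_weightMap_eq_zero [IsDomain R] (s : ℤ → β → R) {r : ℕ}
    {f : K[X] →ₗ[K] TensorAlgebra K V} {g h : Fin r → (K[X] →ₗ[K] TensorAlgebra K V)}
    (hf : PreservesDegree f) (H : PolySplit f g h) (m n : Fin (r + 1) → ℕ) :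
    ∃ j : ℤ, (Matrix.of fun k l => weightMap b s (j - m k) (f (X ^ (m k + n l)))).det = 0 := by
  obtain ⟨q, hm, hn⟩ : ∃ q, (∀ k, m k ≤ q) ∧ ∀ l, n l ≤ q :=
    ⟨max (Finset.univ.sup m) (Finset.univ.sup n),
      fun k => le_max_of_le_left (Finset.le_sup (Finset.mem_univ k)),
      fun l => le_max_of_le_right (Finset.le_sup (Finset.mem_univ l))⟩
  let N := 2 * q * r + 1
  let M := N + 2 * q
  let column (c : Fin N × Fin (r + 1)) : Fin M := ⟨q + c.1 + n c.2, by have := hn c.2; omega⟩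
  obtain ⟨y, hy, relation⟩ := H.exists_mulVec_relation (shiftRep b s M) (fun c => X ^ n c.2) column
    (by simp only [Fintype.card_prod, Fintype.card_fin, M, N]; ring_nf; omega)
  obtain ⟨⟨j, l₀⟩, hj⟩ := Function.ne_iff.1 hy
  refine ⟨(q + j : ℕ), Matrix.exists_mulVec_eq_zero_iff.1
    ⟨fun l => y (j, l), Function.ne_iff.2 ⟨l₀, hj⟩, funext fun k => ?_⟩⟩
  have hmk := hm k
  let row : Fin M := ⟨q + j - m k, by omega⟩
  have row_eq : ((row : ℕ) : ℤ) = (q + j : ℕ) - m k := by simp only [row]; omega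
  refine Eq.trans ?_ (relation (X ^ m k) row)
  have column_iff (j' : Fin N) (l : Fin (r + 1)) :
      (column (j', l) : ℕ) = row + (m k + n l) ↔ j' = j := by
    simp only [column, row, Fin.ext_iff]
    omega
  simp only [← pow_add, shiftRep_apply b s (hf _), row_eq, column_iff, Fintype.sum_prod_type_right,
    ite_mul, zero_mul, Finset.sum_ite_eq', Finset.mem_univ, if_true]
  rfl

/-- The Hankel matrix of `f` with weights in `R`: the entry at `(m, n)` is the value of
`weightMap b s` on `f (X ^ (m + n))`, whose words are written on the places from `-m` to `n - 1`. -/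
noncomputable def hankelMatrix (s : ℤ → β → R) :
    (K[X] →ₗ[K] TensorAlgebra K V) →ₗ[K] Matrix ℕ ℕ R where
  toFun f := Matrix.of fun m n => weightMap b s (-m) (f (X ^ (m + n)))
  map_add' f g := by ext; simp
  map_smul' c f := by ext; simp

theorem hankelMatrix_apply (s : ℤ → β → R) (f : K[X] →ₗ[K] TensorAlgebra K V) (m n : ℕ) :
    hankelMatrix b s f m n = weightMap b s (-m) (f (X ^ (m + n))) := rfl

theorem map_hankelMatrix {R' : Type*} [CommRing R'] [Algebra K R'] (η : R →ₐ[K] R')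
    (s : ℤ → β → R) (f : K[X] →ₗ[K] TensorAlgebra K V) :
    (hankelMatrix b s f).map η = hankelMatrix b (fun j x => η (s j x)) f :=
  Matrix.ext fun _ _ => map_weightMap b η s _ _

variable (K β) in
/-- The weights that are pairwise distinct indeterminates. -/
noncomputable def genericWeight (j : ℤ) (x : β) : MvPolynomial (ℤ × β) K := MvPolynomial.X (j, x)

theorem map_hankelMatrix_genericWeight (s : ℤ → β → R) (f : K[X] →ₗ[K] TensorAlgebra K V) :
    (hankelMatrix b (genericWeight K β) f).map (MvPolynomial.aeval fun p => s p.1 p.2) =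
      hankelMatrix b s f := by
  simp [map_hankelMatrix, genericWeight]

-- Generic weights may be shifted, so the place in `exists_det_weightMap_eq_zero` is immaterial.
theorem det_hankelMatrix_genericWeight_eq_zero [IsDomain K] {r : ℕ}
    {f : K[X] →ₗ[K] TensorAlgebra K V} {g h : Fin r → (K[X] →ₗ[K] TensorAlgebra K V)}
    (hf : PreservesDegree f) (H : PolySplit f g h) (m n : Fin (r + 1) → ℕ) :
    ((hankelMatrix b (genericWeight K β) f).submatrix m n).det = 0 := by
  obtain ⟨j, hj⟩ := exists_det_weightMap_eq_zero b (genericWeight K β) hf H m n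
  let shift : ℤ × β → ℤ × β := fun p => (p.1 + j, p.2)
  have shift_injective : Function.Injective shift := fun p p' hp => by
    simpa [shift, Prod.ext_iff] using hp
  refine (map_eq_zero_iff _ (MvPolynomial.rename_injective (R := K) shift shift_injective)).1 ?_
  rw [AlgHom.map_det, ← hj]
  congr 1
  ext1 k l
  refine (map_weightMap b (MvPolynomial.rename shift) _ _ _).trans ?_
  have rename_genericWeight : (fun i x => MvPolynomial.rename shift (genericWeight K β i x)) =
      fun i => genericWeight K β (i + j) := by
    funext i x
    exact MvPolynomial.rename_X _ _
  rw [rename_genericWeight, weightMap_shift, neg_add_eq_sub, Matrix.of_apply]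

theorem det_hankelMatrix_eq_zero_of_genericWeight {ι : Type*} [Fintype ι] [DecidableEq ι]
    {f : K[X] →ₗ[K] TensorAlgebra K V} {m n : ι → ℕ}
    (h : ((hankelMatrix b (genericWeight K β) f).submatrix m n).det = 0) (s : ℤ → β → R) :
    ((hankelMatrix b s f).submatrix m n).det = 0 := by
  have map_det := AlgHom.map_det (MvPolynomial.aeval fun p : ℤ × β => s p.1 p.2)
    ((hankelMatrix b (genericWeight K β) f).submatrix m n)
  rwa [h, map_zero, AlgHom.mapMatrix_apply, ← Matrix.submatrix_map, map_hankelMatrix_genericWeight,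
    eq_comm] at map_det

theorem hankelMatrix_genericWeight_eq_zero_iff {f : K[X] →ₗ[K] TensorAlgebra K V}
    (hf : PreservesDegree f) (m n : ℕ) :
    hankelMatrix b (genericWeight K β) f m n = 0 ↔
      ∀ w : FreeMonoid β, w.length = m + n → wordCoef b w f = 0 := by
  constructor
  · intro h w hw
    have eval : hankelMatrix b (indicatorWeight K (-m) w.toList) f m n = 0 := by
      rw [← map_hankelMatrix_genericWeight, Matrix.map_apply, h, map_zero]
    rw [wordCoef_apply, ← weightMap_indicatorWeight b (-m) (hf _), hw, ← hankelMatrix_apply, eval]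
  · intro h
    have apply_X_pow : f (X ^ (m + n)) = 0 :=
      ext_of_mem_range_ι_pow b (hf _) (zero_mem _) fun w hw => by
        rw [← hw, ← wordCoef_apply, h w hw, map_zero]
    rw [hankelMatrix_apply, apply_X_pow, map_zero]

theorem contract_basis {u u' w w' : FreeMonoid β} (hu : u'.length = u.length)
    (hw : w'.length = w.length) (v : FreeMonoid β) [Decidable (u' = u ∧ w' = w)] :
    contract b u w (b.tensorAlgebra (u' * v * w')) =
      if u' = u ∧ w' = w then b.tensorAlgebra v else 0 := by
  refine b.tensorAlgebra.ext_elem fun v' => ?_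
  have mul_eq_mul : u' * v * w' = u * v' * w ↔ (u' = u ∧ w' = w) ∧ v = v' := by
    constructor
    · intro h
      obtain ⟨h, hw⟩ := List.append_inj' h hw
      obtain ⟨hu, hv⟩ := List.append_inj h hu
      exact ⟨⟨hu, hw⟩, hv⟩
    · rintro ⟨⟨rfl, rfl⟩, rfl⟩
      rfl
  refine (coord_contract b u v' w _).trans ?_
  classical
  simp only [Module.Basis.coord_apply, Module.Basis.repr_self, Finsupp.single_apply, mul_eq_mul]
  split_ifs <;> simp_all

theorem hankelMatrix_wordTranslate {s s' : ℤ → β → R} {m n : ℕ} {u w : FreeMonoid β}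
    (hu : ∀ j x, -(m + u.length : ℤ) ≤ j → j < -m →
      s j x = indicatorWeight R (-(m + u.length)) u.toList j x)
    (hs : ∀ j x, -(m : ℤ) ≤ j → j < n → s j x = s' j x)
    (hw : ∀ j x, (n : ℤ) ≤ j → j < n + w.length → s j x = indicatorWeight R n w.toList j x)
    {f : K[X] →ₗ[K] TensorAlgebra K V} (hf : PreservesDegree f) :
    hankelMatrix b s' (wordTranslate b u w f) m n =
      hankelMatrix b s f (m + u.length) (n + w.length) := by
  classical
  have exponent : m + u.length + (n + w.length) = u.length + (m + n) + w.length := by ring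
  rw [hankelMatrix_apply, hankelMatrix_apply, wordTranslate_apply_X_pow, exponent]
  refine eq_of_mem_range_ι_pow b (φ := weightMap b s' (-m) ∘ₗ contract b u w)
    (fun x hx => ?_) (hf _)
  obtain ⟨x, w', rfl, hx, hw'⟩ := exists_eq_mul_of_length_eq_add hx
  obtain ⟨u', v, rfl, hu', hv⟩ := exists_eq_mul_of_length_eq_add hx
  have start_v : -(m + u.length : ℤ) + u.toList.length = -m := by
    change -(m + u.length : ℤ) + u.length = -m
    ring
  have start_w : -(m : ℤ) + v.toList.length = n := by
    change -(m : ℤ) + v.length = n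
    rw [hv, Nat.cast_add, neg_add_cancel_left]
  have weight_eq := wordWeight_append_append (s' := s') (v := v.toList) hu' hw'
    (fun j x hj hj' => hu j x hj (start_v ▸ hj'))
    (by rw [start_v, start_w]; exact hs) (by rw [start_v, start_w]; exact hw)
  rw [start_v] at weight_eq
  rw [LinearMap.comp_apply, contract_basis b hu' hw' v, weightMap_basis, Nat.cast_add,
    FreeMonoid.toList_mul, FreeMonoid.toList_mul, weight_eq]
  simp only [EmbeddingLike.apply_eq_iff_eq]
  split_ifs <;> simp [weightMap_basis]

/-- The weights `s` on the places from `-q` to `q - 1`, extended so as to single out the word `u`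
to the left of them and the word `w` to the right. -/
noncomputable def patchedWeight (s : ℤ → β → R) (q : ℕ) (u w : FreeMonoid β) (j : ℤ) : β → R :=
  if j < -q then indicatorWeight R (-(q + u.length)) u.toList j
  else if j < q then s j
  else indicatorWeight R q w.toList j

section Patched

variable (s : ℤ → β → R) {q : ℕ} {m n : ℕ} (u w : FreeMonoid β)
  {f : K[X] →ₗ[K] TensorAlgebra K V}

theorem patchedWeight_of_lt {j : ℤ} (hj : j < -q) :
    patchedWeight s q u w j = indicatorWeight R (-(q + u.length)) u.toList j := if_pos hj

theorem patchedWeight_of_mem {j : ℤ} (hj : -q ≤ j) (hj' : j < q) :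
    patchedWeight s q u w j = s j := by
  rw [patchedWeight, if_neg (not_lt.2 hj), if_pos hj']

theorem patchedWeight_of_le {j : ℤ} (hj : q ≤ j) :
    patchedWeight s q u w j = indicatorWeight R q w.toList j := by
  rw [patchedWeight, if_neg (by omega), if_neg (by omega)]

theorem hankelMatrix_patchedWeight (hf : PreservesDegree f) :
    hankelMatrix b (patchedWeight s q u w) f (q + u.length) (q + w.length) =
      hankelMatrix b s (wordTranslate b u w f) q q :=
  (hankelMatrix_wordTranslate b
    (fun _ _ _ hj => congrFun (patchedWeight_of_lt s u w hj) _)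
    (fun _ _ hj hj' => congrFun (patchedWeight_of_mem s u w hj hj') _)
    (fun _ _ hj _ => congrFun (patchedWeight_of_le s u w hj) _) hf).symm

theorem hankelMatrix_patchedWeight_left (hf : PreservesDegree f) (hn : n < q) :
    hankelMatrix b (patchedWeight s q u w) f (q + u.length) n =
      hankelMatrix b s (wordTranslate b u 1 f) q n :=
  (hankelMatrix_wordTranslate b (w := 1)
    (fun _ _ _ hj => congrFun (patchedWeight_of_lt s u w hj) _)
    (fun _ _ hj hj' => congrFun (patchedWeight_of_mem s u w hj (by omega)) _)
    (fun _ _ hj hj' => absurd hj (by simpa using hj')) hf).symm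

theorem hankelMatrix_patchedWeight_right (hf : PreservesDegree f) (hm : m < q) :
    hankelMatrix b (patchedWeight s q u w) f m (q + w.length) =
      hankelMatrix b s (wordTranslate b 1 w f) m q :=
  (hankelMatrix_wordTranslate b (u := 1)
    (fun _ _ hj hj' => absurd hj (by simpa using hj'))
    (fun _ _ hj hj' => congrFun (patchedWeight_of_mem s u w (by omega) hj') _)
    (fun _ _ hj _ => congrFun (patchedWeight_of_le s u w hj) _) hf).symm

theorem hankelMatrix_patchedWeight_middle (hf : PreservesDegree f) (hm : m < q) (hn : n < q) :
    hankelMatrix b (patchedWeight s q u w) f m n = hankelMatrix b s f m n :=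
  eq_of_mem_range_ι_pow b (φ := weightMap b (patchedWeight s q u w) (-m))
      (ψ := weightMap b s (-m)) (fun x hx => by
    rw [weightMap_basis, weightMap_basis]
    refine wordWeight_congr fun j y hj hj' => ?_
    change j < _ + (x.length : ℤ) at hj'
    exact congrFun (patchedWeight_of_mem s u w (by omega) (by omega)) y) (hf _)

end Patched

/-- The span of the translates `wordTranslate b u 1 f`, that is, the row space of the matrix of the
`wordCoef b (u * w) f`. -/
noncomputable def leftTranslates (f : K[X] →ₗ[K] TensorAlgebra K V) :
    Submodule K (K[X] →ₗ[K] TensorAlgebra K V) :=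
  Submodule.span K (Set.range fun u => wordTranslate b u 1 f)

/-- The span of the translates `wordTranslate b 1 w f`, that is, the column space of the matrix of
the `wordCoef b (u * w) f`. -/
noncomputable def rightTranslates (f : K[X] →ₗ[K] TensorAlgebra K V) :
    Submodule K (K[X] →ₗ[K] TensorAlgebra K V) :=
  Submodule.span K (Set.range fun w => wordTranslate b 1 w f)

theorem PreservesDegree.of_mem_span {S : Set (K[X] →ₗ[K] TensorAlgebra K V)}
    (hS : ∀ f ∈ S, PreservesDegree f) {F : K[X] →ₗ[K] TensorAlgebra K V}
    (hF : F ∈ Submodule.span K S) : PreservesDegree F := fun n =>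
  have span_le : Submodule.span K S ≤
      (LinearMap.range (TensorAlgebra.ι K (M := V)) ^ n).comap (LinearMap.applyₗ (X ^ n)) :=
    Submodule.span_le.2 fun f hf => hS f hf n
  span_le hF

theorem PreservesDegree.of_mem_leftTranslates {f F : K[X] →ₗ[K] TensorAlgebra K V}
    (hf : PreservesDegree f) (hF : F ∈ leftTranslates b f) : PreservesDegree F :=
  .of_mem_span (by rintro _ ⟨u, rfl⟩; exact hf.wordTranslate b u 1) hF

theorem PreservesDegree.of_mem_rightTranslates {f F : K[X] →ₗ[K] TensorAlgebra K V}
    (hf : PreservesDegree f) (hF : F ∈ rightTranslates b f) : PreservesDegree F :=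
  .of_mem_span (by rintro _ ⟨w, rfl⟩; exact hf.wordTranslate b 1 w) hF

theorem exists_hankelMatrix_wordTranslate_eq [IsDomain K] {r : ℕ}
    {f : K[X] →ₗ[K] TensorAlgebra K V} {g h : Fin r → (K[X] →ₗ[K] TensorAlgebra K V)}
    (hf : PreservesDegree f) (H : PolySplit f g h) :
    ∃ (q p : ℕ) (k l : Fin p → ℕ) (Δ : MvPolynomial (ℤ × β) K)
      (C D : FreeMonoid β → Fin p → MvPolynomial (ℤ × β) K),
      (∀ i, k i < q) ∧ (∀ i, l i < q) ∧ Δ ≠ 0 ∧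
      (∀ u w, Δ * hankelMatrix b (genericWeight K β) (wordTranslate b u w f) q q =
        ∑ j, C u j * hankelMatrix b (genericWeight K β) (wordTranslate b 1 w f) (k j) q) ∧
      ∀ u w, Δ * hankelMatrix b (genericWeight K β) (wordTranslate b u w f) q q =
        ∑ i, D w i * hankelMatrix b (genericWeight K β) (wordTranslate b u 1 f) q (l i) := by
  obtain ⟨p, k, l, hdet, hminor⟩ :=
    exists_maximal_minor (det_hankelMatrix_genericWeight_eq_zero b hf H)
  obtain ⟨q, hk, hl⟩ : ∃ q, (∀ i, k i < q) ∧ ∀ i, l i < q :=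
    ⟨max (Finset.univ.sup k) (Finset.univ.sup l) + 1,
      fun i => Nat.lt_succ_of_le <| le_max_of_le_left (Finset.le_sup (Finset.mem_univ i)),
      fun i => Nat.lt_succ_of_le <| le_max_of_le_right (Finset.le_sup (Finset.mem_univ i))⟩
  let A := hankelMatrix b (genericWeight K β)
  let adj := ((A f).submatrix k l).adjugate
  have factor (u w) : ((A f).submatrix k l).det * A (wordTranslate b u w f) q q =
      ∑ j, (∑ i, A (wordTranslate b u 1 f) q (l i) * adj i j) *
        A (wordTranslate b 1 w f) (k j) q := by
    let s := patchedWeight (genericWeight K β) q u w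
    have submatrix_eq : (hankelMatrix b s f).submatrix k l = (A f).submatrix k l :=
      Matrix.ext fun i j => hankelMatrix_patchedWeight_middle b _ u w hf (hk i) (hl j)
    have bordered := det_submatrix_mul_eq (submatrix_eq ▸ hdet)
      (fun k' l' => det_hankelMatrix_eq_zero_of_genericWeight b (hminor k' l') s)
      (q + u.length) (q + w.length)
    simpa only [submatrix_eq, s, hankelMatrix_patchedWeight b _ u w hf,
      hankelMatrix_patchedWeight_left b _ u w hf (hl _),
      hankelMatrix_patchedWeight_right b _ u w hf (hk _)] using bordered
  refine ⟨q, p, k, l, _, _, fun w i => ∑ j, adj i j * A (wordTranslate b 1 w f) (k j) q,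
    hk, hl, hdet, factor, fun u w => (factor u w).trans ?_⟩
  simp only [Finset.sum_mul]
  rw [Finset.sum_comm]
  exact Finset.sum_congr rfl fun i _ => Finset.sum_congr rfl fun j _ => by ring

theorem eq_zero_of_mem_span_of_wordCoef_eq_zero [IsDomain K] {α ι : Type*} [Fintype ι] {q : ℕ}
    {S : Set (K[X] →ₗ[K] TensorAlgebra K V)} (hS : ∀ f ∈ S, PreservesDegree f)
    {u w : α → FreeMonoid β} (huw : ∀ x, q + q ≤ x.length → ∃ a v, x = u a * v * w a ∧
      v.length = q + q)
    {Δ : MvPolynomial (ℤ × β) K} (hΔ : Δ ≠ 0) {C : α → ι → MvPolynomial (ℤ × β) K}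
    {m n : ι → ℕ} (hmn : ∀ i, m i + n i < q + q)
    (h : ∀ a, ∀ f ∈ S, Δ * hankelMatrix b (genericWeight K β) (wordTranslate b (u a) (w a) f) q q =
      ∑ i, C a i * hankelMatrix b (genericWeight K β) f (m i) (n i))
    {F : K[X] →ₗ[K] TensorAlgebra K V} (hF : F ∈ Submodule.span K S)
    (hcoef : ∀ x, x.length < q + q → wordCoef b x F = 0) : F = 0 := by
  have hdeg : PreservesDegree F := .of_mem_span hS hF
  have factor (a) :
      Δ * hankelMatrix b (genericWeight K β) (wordTranslate b (u a) (w a) F) q q =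
        ∑ i, C a i * hankelMatrix b (genericWeight K β) F (m i) (n i) := by
    clear hcoef hdeg
    induction hF using Submodule.span_induction with
    | mem F hF => exact h a F hF
    | zero => simp
    | add F G _ _ hF hG => simp [mul_add, hF, hG, Finset.sum_add_distrib]
    | smul c F _ hF => simp [hF, Finset.smul_sum]
  have entry_eq_zero (i) : hankelMatrix b (genericWeight K β) F (m i) (n i) = 0 :=
    (hankelMatrix_genericWeight_eq_zero_iff b hdeg _ _).2 fun x hx => hcoef x (hx ▸ hmn i)
  simp only [entry_eq_zero, mul_zero, Finset.sum_const_zero, mul_eq_zero_iff_left hΔ] at factor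
  refine hdeg.ext b (fun _ => zero_mem _) fun x => ?_
  rw [map_zero]
  obtain hx | hx := lt_or_ge x.length (q + q)
  · exact hcoef x hx
  · obtain ⟨a, v, rfl, hv⟩ := huw x hx
    rw [← wordCoef_wordTranslate]
    exact
      (hankelMatrix_genericWeight_eq_zero_iff b (hdeg.wordTranslate b _ _) q q).1 (factor a) v hv

theorem exists_eq_zero_of_wordCoef_eq_zero [IsDomain K] {r : ℕ}
    {f : K[X] →ₗ[K] TensorAlgebra K V} {g h : Fin r → (K[X] →ₗ[K] TensorAlgebra K V)}
    (hf : PreservesDegree f) (H : PolySplit f g h) :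
    ∃ N, (∀ F ∈ leftTranslates b f, (∀ x, x.length < N → wordCoef b x F = 0) → F = 0) ∧
      ∀ F ∈ rightTranslates b f, (∀ x, x.length < N → wordCoef b x F = 0) → F = 0 := by
  obtain ⟨q, p, k, l, Δ, C, D, hk, hl, hΔ, factor_right, factor_left⟩ :=
    exists_hankelMatrix_wordTranslate_eq b hf H
  refine ⟨q + q, fun F => ?_, fun F => ?_⟩
  · refine eq_zero_of_mem_span_of_wordCoef_eq_zero b (u := 1) (w := id) (C := D)
      (by rintro _ ⟨u, rfl⟩; exact hf.wordTranslate b u 1) (fun x hx => ?_) hΔ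
      (fun i => Nat.add_lt_add_left (hl i) q) ?_
    · obtain ⟨v, w, rfl, hv, -⟩ := exists_eq_mul_of_length_eq_add (Nat.add_sub_of_le hx).symm
      exact ⟨w, v, by simp, hv⟩
    · rintro w _ ⟨u, rfl⟩
      simpa [wordTranslate_wordTranslate] using factor_left u w
  · refine eq_zero_of_mem_span_of_wordCoef_eq_zero b (u := id) (w := 1) (C := C)
      (by rintro _ ⟨w, rfl⟩; exact hf.wordTranslate b 1 w) (fun x hx => ?_) hΔ
      (fun i => Nat.add_lt_add_right (hk i) q) ?_
    · obtain ⟨u, v, rfl, -, hv⟩ := exists_eq_mul_of_length_eq_add (Nat.sub_add_cancel hx).symm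
      exact ⟨u, v, by simp, hv⟩
    · rintro u _ ⟨w, rfl⟩
      simpa [wordTranslate_wordTranslate] using factor_right u w

theorem finite_setOf_wordCoef_ne_zero (f : K[X] →ₗ[K] TensorAlgebra K V) (N : ℕ) :
    {w : FreeMonoid β | w.length < N ∧ wordCoef b w f ≠ 0}.Finite := by
  refine ((Finset.range N).finite_toSet.biUnion fun n _ =>
    (b.tensorAlgebra.repr (f (X ^ n))).hasFiniteSupport).subset fun w hw => ?_
  exact Set.mem_biUnion (Finset.mem_coe.2 (Finset.mem_range.2 hw.1)) hw.2

theorem finite_setOf_wordTranslate_ne_zero {f : K[X] →ₗ[K] TensorAlgebra K V} {N : ℕ}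
    (hN : ∀ F ∈ rightTranslates b f, (∀ x, x.length < N → wordCoef b x F = 0) → F = 0) :
    {w : FreeMonoid β | w.length < N ∧ wordTranslate b 1 w f ≠ 0}.Finite := by
  refine ((finite_setOf_wordCoef_ne_zero b f (N + N)).biUnion fun x _ =>
    x.toList.tails.finite_toSet).subset fun (w : FreeMonoid β) ⟨hw, hw_ne⟩ => ?_
  obtain ⟨u, hu, hcoef⟩ : ∃ u, u.length < N ∧ wordCoef b u (wordTranslate b 1 w f) ≠ 0 := by
    contrapose! hw_ne
    exact hN _ (Submodule.subset_span ⟨w, rfl⟩) hw_ne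
  rw [wordCoef_wordTranslate, one_mul] at hcoef
  refine Set.mem_biUnion (x := u * w) ⟨?_, hcoef⟩ ((List.mem_tails _ _).2 ⟨u.toList, rfl⟩)
  rw [FreeMonoid.length_mul]
  exact add_lt_add hu hw

theorem wordCoef_eq_zero_of_wordTranslate_eq_zero {f F : K[X] →ₗ[K] TensorAlgebra K V}
    (hF : F ∈ leftTranslates b f) {w : FreeMonoid β} (hw : wordTranslate b 1 w f = 0) :
    wordCoef b w F = 0 := by
  refine (Submodule.span_le (p := LinearMap.ker (wordCoef b w))).2 ?_ hF
  rintro _ ⟨u, rfl⟩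
  have coef_eq := wordCoef_wordTranslate b 1 u w f
  rw [hw, map_zero, one_mul] at coef_eq
  simp [← coef_eq]

end Hankel

/-! ### Splitting a representative map into its translates -/

section Translates

variable {K : Type u} [Field K] {V : Type v} [AddCommGroup V] [Module K V]
  {β : Type*} (b : Module.Basis β K V)

theorem exists_eq_sum_smul_of_separating {A ι : Type*} [AddCommGroup A] [Module K A] [Fintype ι]
    (L : Submodule K A) (φ : ι → A →ₗ[K] K) (h : ∀ x ∈ L, (∀ i, φ i x = 0) → x = 0) :
    ∃ e : ι → A, (∀ i, e i ∈ L) ∧ ∀ x ∈ L, x = ∑ i, φ i x • e i := by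
  classical
  let coords : L →ₗ[K] (ι → K) := LinearMap.pi fun i => φ i ∘ₗ L.subtype
  obtain ⟨s, hs⟩ := coords.exists_leftInverse_of_injective
    (LinearMap.ker_eq_bot'.2 fun x hx => Subtype.ext (h x x.2 (congrFun hx)))
  refine ⟨fun i => s fun j => if i = j then 1 else 0, fun i => (s _).2, fun x hx => ?_⟩
  calc x
    _ = s (coords ⟨x, hx⟩) := (congrArg Subtype.val (LinearMap.congr_fun hs ⟨x, hx⟩)).symm
    _ = ∑ i, φ i x • (s fun j => if i = j then 1 else 0 : A) := by
      rw [LinearMap.pi_apply_eq_sum_univ s, Submodule.coe_sum]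
      rfl

theorem exists_polySplit_translates {r : ℕ} {f : K[X] →ₗ[K] TensorAlgebra K V}
    {g h : Fin r → (K[X] →ₗ[K] TensorAlgebra K V)} (hf : PreservesDegree f)
    (H : PolySplit f g h) :
    ∃ (n : ℕ) (g h : Fin n → (K[X] →ₗ[K] TensorAlgebra K V)),
      (∀ i, g i ∈ rightTranslates b f) ∧ (∀ i, h i ∈ leftTranslates b f) ∧ PolySplit f g h := by
  obtain ⟨N, hleft, hright⟩ := exists_eq_zero_of_wordCoef_eq_zero b hf H
  let W := {w : FreeMonoid β | w.length < N ∧ wordTranslate b 1 w f ≠ 0}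
  have : Finite W := finite_setOf_wordTranslate_ne_zero b hright
  obtain ⟨n, ⟨index⟩⟩ := Finite.exists_equiv_fin W
  have separating : ∀ F ∈ leftTranslates b f,
      (∀ i, wordCoef b (index.symm i).1 F = 0) → F = 0 := fun F hF hF0 => hleft F hF fun w hw => by
    by_cases hw_zero : wordTranslate b 1 w f = 0
    · exact wordCoef_eq_zero_of_wordTranslate_eq_zero b hF hw_zero
    · simpa using hF0 (index ⟨w, hw, hw_zero⟩)
  obtain ⟨h, hh, sum_eq⟩ := exists_eq_sum_smul_of_separating _ _ separating
  have hg i : wordTranslate b 1 (index.symm i).1 f ∈ rightTranslates b f :=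
    Submodule.subset_span ⟨_, rfl⟩
  refine ⟨n, _, h, hg, hh, (polySplit_iff_wordCoef b hf
    (fun i => hf.of_mem_rightTranslates b (hg i))
    fun i => hf.of_mem_leftTranslates b (hh i)).2 fun u w => ?_⟩
  simpa using congrArg (wordCoef b w)
    (sum_eq (wordTranslate b u 1 f) (Submodule.subset_span ⟨u, rfl⟩))

theorem wordTranslate_mem_BLRep (f : BLRep K V) (u w : FreeMonoid β) :
    wordTranslate b u w f.1 ∈ BLRep K V := by
  obtain ⟨hf, _, _, _, H⟩ := f.2
  obtain ⟨n, g, h, hg, hh, split⟩ := exists_polySplit_translates b hf H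
  replace hg i := hf.of_mem_rightTranslates b (hg i)
  replace hh i := hf.of_mem_leftTranslates b (hh i)
  refine ⟨hf.wordTranslate b u w, n, fun i => wordTranslate b u 1 (g i),
    fun i => wordTranslate b 1 w (h i), (polySplit_iff_wordCoef b (hf.wordTranslate b u w)
      (fun i => (hg i).wordTranslate b u 1) fun i => (hh i).wordTranslate b 1 w).2 fun x y => ?_⟩
  simpa [mul_assoc] using (polySplit_iff_wordCoef b hf hg hh).1 split (u * x) (y * w)

theorem exists_polySplit_BLRep (f : BLRep K V) : ∃ (n : ℕ) (g h : Fin n → BLRep K V),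
    PolySplit f.1 (fun i => (g i).1) (fun i => (h i).1) := by
  let b := Module.Basis.ofVectorSpace K V
  obtain ⟨hf, _, _, _, H⟩ := f.2
  obtain ⟨n, g, h, hg, hh, split⟩ := exists_polySplit_translates b hf H
  have leftTranslates_le : leftTranslates b f.1 ≤ BLRep K V :=
    Submodule.span_le.2 (by rintro _ ⟨u, rfl⟩; exact wordTranslate_mem_BLRep b f u 1)
  have rightTranslates_le : rightTranslates b f.1 ≤ BLRep K V :=
    Submodule.span_le.2 (by rintro _ ⟨w, rfl⟩; exact wordTranslate_mem_BLRep b f 1 w)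
  exact ⟨n, fun i => ⟨g i, rightTranslates_le (hg i)⟩,
    fun i => ⟨h i, leftTranslates_le (hh i)⟩, split⟩

end Translates

/-! ### Coalgebras of functions on a monoid -/

section SplitCoalgebra

open Module TensorProduct

variable {K : Type u} [Field K] {A B : Type*} [AddCommGroup A] [Module K A] [AddCommGroup B]
  [Module K B]

theorem eq_zero_of_dualDistrib_eq_zero {ι κ : Type*} (E : ι → Dual K A) (F : κ → Dual K B)
    (hE : ∀ x, (∀ i, E i x = 0) → x = 0) (hF : ∀ y, (∀ j, F j y = 0) → y = 0) {z : A ⊗[K] B}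
    (hz : ∀ i j, dualDistrib K A B (E i ⊗ₜ F j) z = 0) : z = 0 := by
  classical
  let a := Basis.ofVectorSpace K A
  have contract_eq_zero (j) : TensorProduct.rid K A ((F j).lTensor A z) = 0 := by
    have apply_contract (i) : E i ∘ₗ (TensorProduct.rid K A).toLinearMap ∘ₗ (F j).lTensor A =
        dualDistrib K A B (E i ⊗ₜ F j) := TensorProduct.ext' fun x y => by simp [mul_comm]
    exact hE _ fun i => (LinearMap.congr_fun (apply_contract i) z).trans (hz i j)
  have coord_contract (j k) : F j (equivFinsuppOfBasisLeft a z k) =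
      a.coord k (TensorProduct.rid K A ((F j).lTensor A z)) := by
    refine LinearMap.congr_fun (f := F j ∘ₗ Finsupp.lapply k ∘ₗ
      (equivFinsuppOfBasisLeft a).toLinearMap) (g := a.coord k ∘ₗ
      (TensorProduct.rid K A).toLinearMap ∘ₗ (F j).lTensor A) ?_ z
    exact TensorProduct.ext' fun x y => by simp [mul_comm]
  refine (equivFinsuppOfBasisLeft a).map_eq_zero_iff.1 (Finsupp.ext fun k => hF _ fun j => ?_)
  rw [coord_contract, contract_eq_zero, map_zero]

variable {M : Type*} [Monoid M] {E : M → Dual K A}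

theorem exists_comul_of_split (hE : ∀ x, (∀ u, E u x = 0) → x = 0)
    (hsplit : ∀ f : A, ∃ (n : ℕ) (g h : Fin n → A),
      ∀ u w, E (u * w) f = ∑ i, E u (g i) * E w (h i)) :
    ∃ δ : A →ₗ[K] A ⊗[K] A, ∀ u w f, dualDistrib K A A (E u ⊗ₜ E w) (δ f) = E (u * w) f := by
  let eval : A ⊗[K] A →ₗ[K] (M × M → K) :=
    LinearMap.pi fun p => dualDistrib K A A (E p.1 ⊗ₜ E p.2)
  obtain ⟨s, hs⟩ := eval.exists_leftInverse_of_injective <| LinearMap.ker_eq_bot'.2 fun z hz =>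
    eq_zero_of_dualDistrib_eq_zero E E hE hE fun u w => congrFun hz (u, w)
  let μ : A →ₗ[K] (M × M → K) := LinearMap.pi fun p => E (p.1 * p.2)
  have eval_comul (f : A) : eval (s (μ f)) = μ f := by
    obtain ⟨n, g, h, hf⟩ := hsplit f
    have eval_sum : eval (∑ i, g i ⊗ₜ h i) = μ f := by
      ext p
      simp [eval, μ, hf]
    rw [← eval_sum, ← LinearMap.comp_apply s, hs, LinearMap.id_apply]
  exact ⟨s ∘ₗ μ, fun u w f => congrFun (eval_comul f) (u, w)⟩

theorem coassoc_of_dualDistrib_eq (hE : ∀ x, (∀ u, E u x = 0) → x = 0) {δ : A →ₗ[K] A ⊗[K] A}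
    (hδ : ∀ u w f, dualDistrib K A A (E u ⊗ₜ E w) (δ f) = E (u * w) f) :
    (TensorProduct.assoc K A A A).toLinearMap ∘ₗ δ.rTensor A ∘ₗ δ = δ.lTensor A ∘ₗ δ := by
  let E₂ (p : M × M) := dualDistrib K A A (E p.1 ⊗ₜ E p.2)
  have hE₂ (z : A ⊗[K] A) (hz : ∀ p, E₂ p z = 0) : z = 0 :=
    eq_zero_of_dualDistrib_eq_zero E E hE hE fun u w => hz (u, w)
  have eval_assoc_rTensor (u v w) :
      dualDistrib K A (A ⊗[K] A) (E u ⊗ₜ E₂ (v, w)) ∘ₗ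
        (TensorProduct.assoc K A A A).toLinearMap ∘ₗ δ.rTensor A = E₂ (u * v, w) := by
    refine TensorProduct.ext' fun x y => ?_
    have eval_assoc : dualDistrib K A (A ⊗[K] A) (E u ⊗ₜ E₂ (v, w)) ∘ₗ
        (TensorProduct.assoc K A A A).toLinearMap ∘ₗ (TensorProduct.mk K (A ⊗[K] A) A).flip y =
          E w y • E₂ (u, v) :=
      TensorProduct.ext' fun x x' => by simp [E₂]; ring
    have := LinearMap.congr_fun eval_assoc (δ x)
    simpa [E₂, hδ, mul_comm] using this
  have eval_lTensor (u v w) :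
      dualDistrib K A (A ⊗[K] A) (E u ⊗ₜ E₂ (v, w)) ∘ₗ δ.lTensor A = E₂ (u, v * w) :=
    TensorProduct.ext' fun x y => by simp [E₂, hδ]
  refine LinearMap.ext fun f => sub_eq_zero.1 ?_
  refine eq_zero_of_dualDistrib_eq_zero E E₂ hE hE₂ fun u ⟨v, w⟩ => ?_
  rw [map_sub, sub_eq_zero]
  calc _ = E₂ (u * v, w) (δ f) := LinearMap.congr_fun (eval_assoc_rTensor u v w) (δ f)
    _ = E₂ (u, v * w) (δ f) := by simp only [E₂, hδ, mul_assoc]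
    _ = _ := (LinearMap.congr_fun (eval_lTensor u v w) (δ f)).symm

theorem exists_coalgebra_of_split (hE : ∀ x, (∀ u, E u x = 0) → x = 0)
    (hsplit : ∀ f : A, ∃ (n : ℕ) (g h : Fin n → A),
      ∀ u w, E (u * w) f = ∑ i, E u (g i) * E w (h i)) :
    ∃ c : Coalgebra K A,
      (∀ (f : A) (n : ℕ) (g h : Fin n → A), (∀ u w, E (u * w) f = ∑ i, E u (g i) * E w (h i)) →
        c.comul f = ∑ i, g i ⊗ₜ[K] h i) ∧ ∀ f, c.counit f = E 1 f := by
  obtain ⟨δ, hδ⟩ := exists_comul_of_split hE hsplit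
  have comul_eq (f : A) (n : ℕ) (g h : Fin n → A)
      (H : ∀ u w, E (u * w) f = ∑ i, E u (g i) * E w (h i)) : δ f = ∑ i, g i ⊗ₜ[K] h i :=
    sub_eq_zero.1 <| eq_zero_of_dualDistrib_eq_zero E E hE hE fun u w => by
      rw [map_sub, hδ, H]
      simp
  refine ⟨{ comul := δ
            counit := E 1
            coassoc := coassoc_of_dualDistrib_eq hE hδ
            rTensor_counit_comp_comul := LinearMap.ext fun f => ?_
            lTensor_counit_comp_comul := LinearMap.ext fun f => ?_ }, comul_eq, fun _ => rfl⟩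
  all_goals obtain ⟨n, g, h, H⟩ := hsplit f
  · refine (TensorProduct.lid K A).injective (sub_eq_zero.1 (hE _ fun u => ?_))
    simp [comul_eq f n g h H, ← H]
  · refine (TensorProduct.rid K A).injective (sub_eq_zero.1 (hE _ fun u => ?_))
    simp [comul_eq f n g h H, ← H, mul_comm]

end SplitCoalgebra

theorem exists_isBLCoalgebra (K : Type u) [Field K] (V : Type v) [AddCommGroup V] [Module K V] :
    ∃ c : Coalgebra K (BLRep K V), IsBLCoalgebra c := by
  let b := Module.Basis.ofVectorSpace K V
  let E w := wordCoef b w ∘ₗ (BLRep K V).subtype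
  have separating (f : BLRep K V) (hf : ∀ w, E w f = 0) : f = 0 :=
    Subtype.ext (f.2.1.ext b (fun _ => zero_mem _) fun w => (hf w).trans (map_zero _).symm)
  have polySplit_iff (f : BLRep K V) (n : ℕ) (g h : Fin n → BLRep K V) :=
    polySplit_iff_wordCoef b f.2.1 (fun i => (g i).2.1) (fun i => (h i).2.1)
  obtain ⟨c, comul_eq, counit_eq⟩ :=
    exists_coalgebra_of_split (A := BLRep K V) (E := E) separating fun f =>
      have ⟨n, g, h, H⟩ := exists_polySplit_BLRep f
      ⟨n, g, h, (polySplit_iff f n g h).1 H⟩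
  refine ⟨c, exists_polySplit_BLRep,
    fun f n g h H => comul_eq f n g h ((polySplit_iff f n g h).1 H), fun f => ?_⟩
  rw [counit_eq]
  exact algebraMap_wordCoef_one b f.2.1

/-! ### Projections of tensors over `V ⊕ K` -/

section Projections

open GenTree TensorAlgebra

variable {K : Type u} [CommRing K] {V : Type v} [AddCommGroup V] [Module K V]

theorem projDeg_append {m n : ℕ} (α : Fin m → Bool) (γ : Fin n → Bool) :
    projDeg (Fin.append α γ) = projDeg α + projDeg γ := by
  simp only [projDeg, Finset.card_filter, Fin.sum_univ_add, Fin.append_left, Fin.append_right]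

theorem projDeg_succ {n : ℕ} (α : Fin (n + 1) → Bool) :
    projDeg α = (if α 0 then 1 else 0) + projDeg fun k => α k.succ := by
  simp only [projDeg, Finset.card_filter, Fin.sum_univ_succ]

theorem projDeg_true (n : ℕ) : projDeg (fun _ : Fin n => true) = n := by
  simp [projDeg]

theorem projDeg_false (n : ℕ) : projDeg (fun _ : Fin n => false) = 0 := by
  simp [projDeg]

theorem leaf_comb (n : ℕ) : (GradingTree.comb n).leaf = n + 1 := by
  induction n with
  | zero => rfl
  | succ n ih => rw [GradingTree.comb, GradingTree.leaf, ih, GradingTree.leaf]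

theorem projDeg_true_comb (n : ℕ) :
    projDeg (fun _ : Fin (GradingTree.comb n).leaf => true) = n + 1 :=
  (projDeg_true _).trans (leaf_comb n)

theorem exists_projDeg_eq (n : ℕ) : ∃ (t : GradingTree) (α : Fin t.leaf → Bool), projDeg α = n := by
  cases n with
  | zero => exact ⟨.triv, fun _ => false, projDeg_false _⟩
  | succ n => exact ⟨.comb n, fun _ => true, projDeg_true_comb n⟩

/-- The concatenation of projection tuples for two trees. Its type records the joined tree, which
is lost in `Fin.append`. -/
def joinProj {t u : GradingTree} (α : Fin t.leaf → Bool) (γ : Fin u.leaf → Bool) :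
    Fin (GradingTree.join t u).leaf → Bool :=
  Fin.append α γ

theorem projDeg_joinProj {t u : GradingTree} (α : Fin t.leaf → Bool) (γ : Fin u.leaf → Bool) :
    projDeg (joinProj α γ) = projDeg α + projDeg γ :=
  projDeg_append α γ

theorem exists_eq_joinProj {t u : GradingTree} (α : Fin (GradingTree.join t u).leaf → Bool) :
    ∃ (α₁ : Fin t.leaf → Bool) (α₂ : Fin u.leaf → Bool), α = joinProj α₁ α₂ :=
  ⟨fun k => α (Fin.castAdd u.leaf k), fun k => α (Fin.natAdd t.leaf k),
    (Fin.append_castAdd_natAdd (m := t.leaf) (n := u.leaf)).symm⟩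

theorem projMul_succ {n : ℕ} (α : Fin (n + 1) → Bool) (x : Fin (n + 1) → V × K) :
    projMul α x = projTo K V (α 0) (x 0) * projMul (fun k => α k.succ) fun k => x k.succ := by
  simp only [projMul_apply, List.ofFn_succ, List.prod_cons]

theorem projMul_append {m n : ℕ} (α : Fin m → Bool) (γ : Fin n → Bool) (x : Fin m → V × K)
    (y : Fin n → V × K) :
    projMul (Fin.append α γ) (Fin.append x y) = projMul α x * projMul γ y := by
  simp only [projMul_apply, List.ofFn_add, List.prod_append]
  congr 2 <;> simp [Fin.append_right]

theorem projMul_mem_range_ι_pow {n : ℕ} (α : Fin n → Bool) (x : Fin n → V × K) :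
    projMul α x ∈ LinearMap.range (ι K (M := V)) ^ projDeg α := by
  induction n with
  | zero => simp [projMul_apply, projDeg, Submodule.mem_one]
  | succ n ih =>
    rw [projMul_succ, projDeg_succ, pow_add]
    refine Submodule.mul_mem_mul ?_ (ih _ _)
    cases α 0
    · simp [projTo, Submodule.mem_one]
    · simp [projTo]

/-- The linear extension of a projection tuple `α` to all tensors over `V ⊕ K`, the factors of the
result being multiplied in the tensor algebra. -/
noncomputable def projLift {n : ℕ} (α : Fin n → Bool) :
    (⨂[K]^n (V × K)) →ₗ[K] TensorAlgebra K V :=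
  PiTensorProduct.lift (projMul α)

theorem projLift_tprod {n : ℕ} (α : Fin n → Bool) (x : Fin n → V × K) :
    projLift α (PiTensorProduct.tprod K x) = projMul α x :=
  PiTensorProduct.lift.tprod _

theorem projLift_mem_range_ι_pow {n : ℕ} (α : Fin n → Bool) (x : ⨂[K]^n (V × K)) :
    projLift α x ∈ LinearMap.range (ι K (M := V)) ^ projDeg α := by
  induction x using PiTensorProduct.induction_on with
  | smul_tprod c x =>
    rw [map_smul, projLift_tprod]
    exact Submodule.smul_mem _ _ (projMul_mem_range_ι_pow α x)
  | add x y hx hy => exact map_add (projLift α) x y ▸ add_mem hx hy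

theorem treeMul_tprod {t u : GradingTree} (x : Fin t.leaf → V × K) (y : Fin u.leaf → V × K) :
    treeMul (PiTensorProduct.tprod K x : TreePower K (V × K) t)
      (PiTensorProduct.tprod K y : TreePower K (V × K) u) =
      PiTensorProduct.tprod K (Fin.append x y) :=
  TensorPower.tprod_mul_tprod K x y

theorem projLift_treeMul {t u : GradingTree} (α : Fin t.leaf → Bool) (γ : Fin u.leaf → Bool)
    (x : TreePower K (V × K) t) (y : TreePower K (V × K) u) :
    projLift (joinProj α γ) (treeMul x y) = projLift α x * projLift γ y := by
  suffices h : (TensorProduct.mk K _ _).compr₂ (projLift (joinProj α γ) ∘ₗ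
      (TensorPower.mulEquiv (R := K) (M := V × K) (n := t.leaf) (m := u.leaf)).toLinearMap) =
      (LinearMap.mul K (TensorAlgebra K V)).compl₁₂ (projLift α) (projLift γ) from
    LinearMap.congr_fun₂ h x y
  refine PiTensorProduct.ext (MultilinearMap.ext fun x => PiTensorProduct.ext
    (MultilinearMap.ext fun y => ?_))
  change projLift (joinProj α γ) (treeMul (PiTensorProduct.tprod K x) (PiTensorProduct.tprod K y)) =
    projLift α (PiTensorProduct.tprod K x) * projLift γ (PiTensorProduct.tprod K y)
  rw [treeMul_tprod, projLift_tprod, projLift_tprod]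
  exact (projLift_tprod _ _).trans (projMul_append α γ x y)

variable {β : Type*} (b : Module.Basis β K V)

theorem coord_of_ι (i : β) (v : V) :
    b.tensorAlgebra.coord (FreeMonoid.of i) (ι K v) = b.repr v i := by
  classical
  suffices b.tensorAlgebra.coord (FreeMonoid.of i) ∘ₗ ι K = b.coord i from
    LinearMap.congr_fun this v
  refine b.ext fun j => ?_
  rw [LinearMap.comp_apply, ← tensorAlgebra_basis_of]
  simp [Finsupp.single_apply, FreeMonoid.of_injective.eq_iff]

theorem coord_projMul {n : ℕ} (p : Fin n → β ⊕ Unit) (y : Fin n → V × K) :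
    b.tensorAlgebra.coord (FreeMonoid.ofList ((List.ofFn p).filterMap Sum.getLeft?))
      (projMul (fun k => (p k).isLeft) y) =
      ∏ k, (b.prod (Module.Basis.singleton Unit K)).repr (y k) (p k) := by
  induction n with
  | zero => simp [projMul_apply, ← tensorAlgebra_basis_one b]
  | succ n ih =>
    rw [projMul_succ, List.ofFn_succ, Fin.prod_univ_succ, ← ih]
    rcases p 0 with i | _
    · rw [List.filterMap_cons_some (f := Sum.getLeft?) (b := i) rfl, FreeMonoid.ofList_cons,
        coord_mul_of_mem_range_ι_pow]
      · simp [projTo, coord_of_ι, - Module.Basis.coord_apply]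
      · simp [projTo]
    · rw [List.filterMap_cons_none (f := Sum.getLeft?) rfl]
      simp [projTo, ← Algebra.smul_def]

theorem ext_of_projLift [Module.Free K V] {n : ℕ} {x y : ⨂[K]^n (V × K)}
    (h : ∀ α : Fin n → Bool, projLift α x = projLift α y) : x = y := by
  let b := Module.Free.chooseBasis K V
  let P := Basis.piTensorProduct fun _ : Fin n => b.prod (Module.Basis.singleton Unit K)
  have coord_eq (p) : P.coord p =
      b.tensorAlgebra.coord (FreeMonoid.ofList ((List.ofFn p).filterMap Sum.getLeft?)) ∘ₗ
        projLift fun k => (p k).isLeft := by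
    refine PiTensorProduct.ext (MultilinearMap.ext fun z => ?_)
    simp only [LinearMap.compMultilinearMap_apply, LinearMap.comp_apply]
    rw [projLift_tprod, coord_projMul]
    exact Basis.piTensorProduct_repr_tprod_apply _ _ _
  refine P.ext_elem fun p => ?_
  simp only [← Module.Basis.coord_apply, coord_eq, LinearMap.comp_apply, h]

end Projections

/-! ### Homomorphisms generated by trees -/

section Generated

open GenTree

variable {K : Type u} [CommRing K] {V : Type v} [AddCommGroup V] [Module K V]

theorem projLift_treeValue (σ : GenTree K V) (t : GradingTree) (α : Fin t.leaf → Bool) :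
    projLift α (σ.treeValue t) = σ.projValue t α := by
  rw [projValue_eq, treeValue, leafSum, leafSum, map_sum]
  exact Finset.sum_congr rfl fun ι _ => projLift_tprod _ _

theorem treeValue_join (σ : GenTree K V) (t u : GradingTree) :
    σ.treeValue (.join t u) =
      ∑ i : Fin σ.rootWidth, treeMul ((σ.child .L i).treeValue t) ((σ.child .R i).treeValue u) := by
  rw [treeValue, leafSum_join]
  refine Finset.sum_congr rfl fun i _ => ?_
  simp only [treeMul, treeValue, leafSum, TensorProduct.sum_tmul, TensorProduct.tmul_sum, map_sum]
  rw [Finset.sum_comm]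
  exact Finset.sum_congr rfl fun _ _ => Finset.sum_congr rfl fun _ _ => (treeMul_tprod _ _).symm

theorem projValue_join (σ : GenTree K V) (t u : GradingTree) (α : Fin t.leaf → Bool)
    (γ : Fin u.leaf → Bool) :
    σ.projValue (.join t u) (joinProj α γ) =
      ∑ i : Fin σ.rootWidth, (σ.child .L i).projValue t α * (σ.child .R i).projValue u γ := by
  rw [← projLift_treeValue, treeValue_join, map_sum]
  exact Finset.sum_congr rfl fun i _ => by simp only [projLift_treeMul, projLift_treeValue]

theorem projValue_triv (σ : GenTree K V) (α : Fin GradingTree.triv.leaf → Bool) :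
    σ.projValue .triv α = projTo K V (α ⟨0, Nat.one_pos⟩) (σ.label []) := by
  rw [projValue, leafSum_triv]
  exact List.prod_singleton

/-- The homomorphism generated by a generating tree. -/
noncomputable def GenTree.toHom (σ : GenTree K V) : TreeHom K V :=
  DirectSum.toModule K GradingTree _ fun t =>
    (PiTensorProduct.lift (MultilinearMap.mkPiAlgebra K (Fin t.leaf) K)).smulRight
      (DirectSum.lof K GradingTree (TreePower K (V × K)) t (σ.treeValue t))

theorem GenTree.generates_toHom (σ : GenTree K V) : σ.Generates σ.toHom := by
  intro t
  rw [GenTree.toHom, treeBasis, DirectSum.toModule_lof]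
  simp

theorem GenTree.Generates.value_eq {σ : GenTree K V} {f : TreeHom K V} (h : σ.Generates f)
    (t : GradingTree) : f.value t = σ.treeValue t := by
  rw [TreeHom.value, h t, DirectSum.component.lof_self]

theorem TreeHom.ext_treeBasis {f g : TreeHom K V}
    (h : ∀ t, f (treeBasis K t) = g (treeBasis K t)) : f = g := by
  refine DirectSum.linearMap_ext K fun t => PiTensorProduct.ext (MultilinearMap.ext fun x => ?_)
  have tprod_eq_smul : PiTensorProduct.tprod K x =
      (∏ k, x k) • PiTensorProduct.tprod K fun _ : Fin t.leaf => (1 : K) := by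
    rw [← MultilinearMap.map_smul_univ]
    simp
  simp only [LinearMap.compMultilinearMap_apply, LinearMap.comp_apply]
  rw [tprod_eq_smul]
  simp only [map_smul]
  exact congrArg _ (h t)

theorem Nor.ext_value {f g : TreeHom K V} (hf : f ∈ Nor K V) (hg : g ∈ Nor K V)
    (h : ∀ t, f.value t = g.value t) : f = g := by
  obtain ⟨σ, -, hσ⟩ := hf
  obtain ⟨τ, -, hτ⟩ := hg
  refine TreeHom.ext_treeBasis fun t => ?_
  rw [hσ t, hτ t, ← hσ.value_eq, ← hτ.value_eq, h]

theorem exists_treeSplit (f : Nor K V) : ∃ (n : ℕ) (g h : Fin n → Nor K V),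
    TreeSplit f.1 (fun i => (g i).1) (fun i => (h i).1) := by
  obtain ⟨f, σ, hσ, hf⟩ := f
  have normal_child := ((normal_iff σ).1 hσ).2
  refine ⟨σ.rootWidth,
    fun i => ⟨(σ.child .L i).toHom, _, normal_child .L i i.2, generates_toHom _⟩,
    fun i => ⟨(σ.child .R i).toHom, _, normal_child .R i i.2, generates_toHom _⟩, fun t u => ?_⟩
  simp only [hf.value_eq, treeValue_join, (generates_toHom _).value_eq]

end Generated

/-! ### The comparison map -/

section Comparison

open GenTree

variable {K : Type u} [CommRing K] {V : Type v} [AddCommGroup V] [Module K V]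

theorem combValue_zero_eq_projLift (f : TreeHom K V) :
    combValue f 0 = projLift (fun _ => false) (f.value .triv) := by
  suffices h : Algebra.linearMap K (TensorAlgebra K V) ∘ₗ LinearMap.snd K V K ∘ₗ
      (PiTensorProduct.subsingletonEquiv (R := K) (s := fun _ : Fin 1 => V × K) 0).toLinearMap =
      projLift fun _ => false from LinearMap.congr_fun h (f.value .triv)
  ext x
  simp [projLift_tprod, projMul_apply, projTo]

theorem combValue_succ_eq_projLift (f : TreeHom K V) (n : ℕ) :
    combValue f (n + 1) = projLift (fun _ => true) (f.value (.comb n)) := by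
  suffices h : TensorPower.toTensorAlgebra ∘ₗ PiTensorProduct.map
      (fun _ : Fin (GradingTree.comb n).leaf => LinearMap.fst K V K) = projLift fun _ => true from
    LinearMap.congr_fun h (f.value (.comb n))
  ext x
  simp [projLift_tprod, projMul_apply, projTo, PiTensorProduct.map_tprod,
    TensorAlgebra.tprod_apply]

theorem ι_rootValue_fst (f : TreeHom K V) :
    TensorAlgebra.ι K f.rootValue.1 = combValue f 1 := by
  suffices h : TensorAlgebra.ι K ∘ₗ LinearMap.fst K V K ∘ₗ
      (PiTensorProduct.subsingletonEquiv (R := K) (s := fun _ : Fin 1 => V × K) 0).toLinearMap =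
      projLift fun _ => true from
    (LinearMap.congr_fun h (f.value .triv)).trans (combValue_succ_eq_projLift f 0).symm
  ext x
  simp [projLift_tprod, projMul_apply, projTo]

theorem combValue_add (f g : TreeHom K V) : combValue (f + g) = combValue f + combValue g := by
  ext (_ | n) <;> simp [combValue_zero_eq_projLift, combValue_succ_eq_projLift, TreeHom.value]

theorem combValue_smul (c : K) (f : TreeHom K V) : combValue (c • f) = c • combValue f := by
  ext (_ | n) <;> simp [combValue_zero_eq_projLift, combValue_succ_eq_projLift, TreeHom.value]

/-- The linear map `K[X] → TV` that takes `X ^ n` to the value of `f` at the left comb with `n`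
leaves, projected to `V^{⊗ n}`; on normal homomorphisms this is the isomorphism with the
Block–Leroux coalgebra. -/
noncomputable def combMap (K : Type u) [CommRing K] (V : Type v) [AddCommGroup V] [Module K V] :
    TreeHom K V →ₗ[K] (K[X] →ₗ[K] TensorAlgebra K V) where
  toFun f := (Polynomial.basisMonomials K).constr K (combValue f)
  map_add' f g := by rw [combValue_add, map_add]
  map_smul' c f := by rw [combValue_smul, map_smul, RingHom.id_apply]

theorem combMap_X_pow (f : TreeHom K V) (n : ℕ) :
    combMap K V f (Polynomial.X ^ n) = combValue f n := by
  rw [Polynomial.X_pow_eq_monomial]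
  exact Module.Basis.constr_basis (Polynomial.basisMonomials K) K _ n

theorem combMap_one (f : TreeHom K V) :
    combMap K V f 1 = algebraMap K (TensorAlgebra K V) f.rootValue.2 := by
  rw [← pow_zero Polynomial.X, combMap_X_pow, combValue]

theorem preservesDegree_combMap (f : TreeHom K V) : PreservesDegree (combMap K V f) := by
  rintro (_ | n) <;> rw [combMap_X_pow]
  · rw [combValue_zero_eq_projLift, ← projDeg_false]
    exact projLift_mem_range_ι_pow _ _
  · rw [combValue_succ_eq_projLift, ← projDeg_true_comb]
    exact projLift_mem_range_ι_pow _ _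

theorem combMap_eq_projValue {f : TreeHom K V} {σ : GenTree K V} (hσ : σ.WeaklyNormal)
    (hf : σ.Generates f) (t : GradingTree) (α : Fin t.leaf → Bool) :
    combMap K V f (Polynomial.X ^ projDeg α) = σ.projValue t α := by
  rw [combMap_X_pow]
  cases h : projDeg α with
  | zero =>
    rw [combValue_zero_eq_projLift, hf.value_eq, projLift_treeValue]
    exact hσ _ _ _ _ ((projDeg_false _).trans h.symm)
  | succ n =>
    rw [combValue_succ_eq_projLift, hf.value_eq, projLift_treeValue]
    exact hσ _ _ _ _ ((projDeg_true_comb n).trans h.symm)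

theorem combMap_eq_projLift {f : TreeHom K V} (hf : f ∈ Nor K V) (t : GradingTree)
    (α : Fin t.leaf → Bool) :
    combMap K V f (Polynomial.X ^ projDeg α) = projLift α (f.value t) := by
  obtain ⟨σ, hσ, hg⟩ := hf
  rw [combMap_eq_projValue ((normal_iff σ).1 hσ).1 hg, hg.value_eq, projLift_treeValue]

theorem TreeSplit.polySplit_combMap {f : TreeHom K V} (hf : f ∈ Nor K V) {n : ℕ}
    {g h : Fin n → TreeHom K V} (hg : ∀ i, g i ∈ Nor K V) (hh : ∀ i, h i ∈ Nor K V)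
    (H : TreeSplit f g h) :
    PolySplit (combMap K V f) (fun i => combMap K V (g i)) (fun i => combMap K V (h i)) := by
  refine PolySplit.of_pow fun k l => ?_
  obtain ⟨t, α, rfl⟩ := exists_projDeg_eq k
  obtain ⟨u, γ, rfl⟩ := exists_projDeg_eq l
  rw [← projDeg_joinProj, combMap_eq_projLift hf, H t u, map_sum]
  refine Finset.sum_congr rfl fun i _ => ?_
  rw [projLift_treeMul, combMap_eq_projLift (hg i), combMap_eq_projLift (hh i)]

theorem combMap_mem_BLRep (f : Nor K V) : combMap K V f.1 ∈ BLRep K V := by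
  obtain ⟨n, g, h, H⟩ := exists_treeSplit f
  exact ⟨preservesDegree_combMap f.1, n, _, _,
    H.polySplit_combMap f.2 (fun i => (g i).2) fun i => (h i).2⟩

/-- The comparison map from normal homomorphisms to representative maps. -/
noncomputable def norToBL (K : Type u) [CommRing K] (V : Type v) [AddCommGroup V] [Module K V] :
    Nor K V →ₗ[K] BLRep K V :=
  (combMap K V ∘ₗ (Nor K V).subtype).codRestrict _ combMap_mem_BLRep

theorem norToBL_apply (f : Nor K V) : (norToBL K V f).1 = combMap K V f.1 := rfl

theorem polySplit_norToBL {f : Nor K V} {n : ℕ} {g h : Fin n → Nor K V}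
    (H : TreeSplit f.1 (fun i => (g i).1) (fun i => (h i).1)) :
    PolySplit (norToBL K V f).1 (fun i => (norToBL K V (g i)).1)
      (fun i => (norToBL K V (h i)).1) :=
  H.polySplit_combMap f.2 (fun i => (g i).2) fun i => (h i).2

theorem norToBL_injective [Module.Free K V] : Function.Injective (norToBL K V) := by
  intro f g hfg
  have combMap_eq : combMap K V f.1 = combMap K V g.1 := congrArg Subtype.val hfg
  refine Subtype.ext (Nor.ext_value f.2 g.2 fun t => ext_of_projLift fun α => ?_)
  rw [← combMap_eq_projLift f.2, ← combMap_eq_projLift g.2, combMap_eq]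

end Comparison

section Isomorphism

open GenTree

variable (K : Type u) [Field K] (V : Type v) [AddCommGroup V] [Module K V]

/-- A choice of a splitting `f(p q) = ∑_i f_{L,i}(p) f_{R,i}(q)`, `i < width f`, for every
representative map `f`. As in `GenTree`, the width is positive and the parts at other indices are
irrelevant. -/
structure BLSplitting where
  width : BLRep K V → ℕ
  part : Side → BLRep K V → ℕ → BLRep K V
  width_pos : ∀ f, 0 < width f
  split : ∀ f, PolySplit f.1 (fun i : Fin (width f) => (part .L f i).1)
    (fun i : Fin (width f) => (part .R f i).1)

instance BLSplitting.instNonempty : Nonempty (BLSplitting K V) := by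
  have exists_split (f : BLRep K V) : ∃ (n : ℕ) (part : Side → ℕ → BLRep K V), 0 < n ∧
      PolySplit f.1 (fun i : Fin n => (part .L i).1) (fun i : Fin n => (part .R i).1) := by
    obtain ⟨n, g, h, H⟩ := exists_polySplit_BLRep f
    -- One zero summand is added to make the width positive.
    refine ⟨n + 1, fun d i => if hi : i < n then d.casesOn (g ⟨i, hi⟩) (h ⟨i, hi⟩) else 0,
      n.succ_pos, fun p q => ?_⟩
    rw [H p q, Fin.sum_univ_castSucc]
    simp
  choose width part width_pos split using exists_split
  exact ⟨⟨width, fun d f => part f d, width_pos, split⟩⟩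

variable {K V}

namespace BLSplitting

variable (S : BLSplitting K V)

/-- The map reached from `f` by following the parts at the successive steps of a position. -/
def state (f : BLRep K V) : Position → BLRep K V
  | [] => f
  | (d, i) :: r => state (S.part d f i) r

/-- The generating tree of the iterated splittings of `f`: each node is labelled by the components
in `V` and `K` of the map reached there. -/
noncomputable def tree (f : BLRep K V) : GenTree K V where
  width r := S.width (S.state f r)
  width_pos _ := S.width_pos _
  label r := (blProj (S.state f r), TensorAlgebra.algebraMapInv ((S.state f r).1 1))

theorem child_tree (f : BLRep K V) (d : Side) (i : ℕ) :
    (S.tree f).child d i = S.tree (S.part d f i) := rfl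

theorem projTo_label_tree (f : BLRep K V) (a : Bool) :
    projTo K V a ((S.tree f).label []) = f.1 (Polynomial.X ^ if a then 1 else 0) := by
  cases a with
  | false =>
    obtain ⟨c, hc⟩ : ∃ c, algebraMap K (TensorAlgebra K V) c = f.1 1 := by
      simpa [Submodule.mem_one] using f.2.1 0
    change algebraMap K _ (TensorAlgebra.algebraMapInv (f.1 1)) = f.1 1
    rw [← hc, TensorAlgebra.algebraMap_leftInverse]
  | true => exact (ι_blProj f).trans (by simp)

theorem projValue_tree (f : BLRep K V) (t : GradingTree) (α : Fin t.leaf → Bool) :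
    (S.tree f).projValue t α = f.1 (Polynomial.X ^ projDeg α) := by
  induction t generalizing f with
  | triv => exact (projValue_triv _ _).trans <| (projTo_label_tree S f _).trans <|
      congrArg (fun k => f.1 (Polynomial.X ^ k)) (projDeg_succ (n := 0) α).symm
  | join t u iht ihu =>
    obtain ⟨α₁, α₂, rfl⟩ := exists_eq_joinProj α
    rw [projValue_join, projDeg_joinProj, pow_add, S.split f]
    refine Finset.sum_congr rfl fun i _ => ?_
    rw [child_tree, child_tree, iht, ihu]

theorem normal_tree (f : BLRep K V) : (S.tree f).Normal := by
  intro s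
  induction s generalizing f with
  | nil =>
    intro _ t u α γ h
    rw [subtree_nil, projValue_tree, projValue_tree, h]
  | cons p s ih => exact fun hs => ih (S.part p.1 f p.2) hs.2

end BLSplitting

theorem norToBL_surjective : Function.Surjective (norToBL K V) := by
  intro f
  obtain ⟨S⟩ := BLSplitting.instNonempty K V
  have normal := S.normal_tree f
  refine ⟨⟨(S.tree f).toHom, _, normal, generates_toHom _⟩, Subtype.ext ?_⟩
  refine Polynomial.lhom_ext' fun n => LinearMap.ext_ring ?_
  obtain ⟨t, α, rfl⟩ := exists_projDeg_eq n
  have apply_X_pow := combMap_eq_projValue (normal [] trivial) (generates_toHom _) t α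
  simpa [← Polynomial.X_pow_eq_monomial, norToBL_apply, subtree_nil, S.projValue_tree]
    using apply_X_pow

variable (K V) in
theorem exists_isNorCoalgebra : ∃ c : Coalgebra K (Nor K V), IsNorCoalgebra c := by
  -- `TreeHom K V` and hence `Nor K V` come with the structure of an additive monoid only.
  let _ : AddCommGroup (Nor K V) := Module.addCommMonoidToAddCommGroup K
  let b := Module.Basis.ofVectorSpace K V
  let E w := wordCoef b w ∘ₗ combMap K V ∘ₗ (Nor K V).subtype
  have separating (f : Nor K V) (hf : ∀ w, E w f = 0) : f = 0 := by
    refine norToBL_injective (Subtype.ext ?_)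
    exact (preservesDegree_combMap f.1).ext b (preservesDegree_combMap _)
      fun w => (hf w).trans (map_zero (E w)).symm
  have E_mul (f : Nor K V) (n : ℕ) (g h : Fin n → Nor K V)
      (H : TreeSplit f.1 (fun i => (g i).1) (fun i => (h i).1)) (u w) :
      E (u * w) f = ∑ i, E u (g i) * E w (h i) :=
    (polySplit_iff_wordCoef b (preservesDegree_combMap _) (fun _ => preservesDegree_combMap _)
      fun _ => preservesDegree_combMap _).1 (polySplit_norToBL H) u w
  obtain ⟨c, comul_eq, counit_eq⟩ :=
    exists_coalgebra_of_split (A := Nor K V) (E := E) separating fun f =>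
      have ⟨n, g, h, H⟩ := exists_treeSplit f
      ⟨n, g, h, E_mul f n g h H⟩
  refine ⟨c, exists_treeSplit, fun f n g h H => comul_eq f n g h (E_mul f n g h H), fun f => ?_⟩
  refine (TensorAlgebra.algebraMap_inj V _ _).1 ?_
  rw [counit_eq, ← combMap_one]
  exact algebraMap_wordCoef_one b (preservesDegree_combMap f.1)

theorem exists_coalgEquiv {cN : Coalgebra K (Nor K V)} {cB : Coalgebra K (BLRep K V)}
    (hN : IsNorCoalgebra cN) (hB : IsBLCoalgebra cB) :
    ∃ φ : Nor K V ≃ₗc[K] BLRep K V, ∀ f, φ f = norToBL K V f := by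
  let e := LinearEquiv.ofBijective (norToBL K V) ⟨norToBL_injective, norToBL_surjective⟩
  have counit_comp : cB.counit ∘ₗ norToBL K V = cN.counit := by
    refine LinearMap.ext fun f => (TensorAlgebra.algebraMap_inj V _ _).1 ?_
    rw [LinearMap.comp_apply, hB.counit_eq, hN.counit_eq, norToBL_apply, combMap_one]
  have map_comp_comul : TensorProduct.map (norToBL K V) (norToBL K V) ∘ₗ cN.comul =
      cB.comul ∘ₗ norToBL K V := by
    refine LinearMap.ext fun f => ?_
    obtain ⟨n, g, h, H⟩ := hN.exists_split f
    rw [LinearMap.comp_apply, LinearMap.comp_apply, hN.comul_eq f n g h H,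
      hB.comul_eq _ n _ _ (polySplit_norToBL H), map_sum]
    rfl
  exact ⟨⟨⟨norToBL K V, counit_comp, map_comp_comul⟩, e.symm, e.left_inv, e.right_inv⟩,
    fun _ => rfl⟩

end Isomorphism

theorem mainTheorem3 (K : Type u) [Field K] (V : Type v) [AddCommGroup V] [Module K V] :
    ∃ (cN : Coalgebra K (Nor K V)) (cB : Coalgebra K (BLRep K V)),
      IsNorCoalgebra cN ∧ IsBLCoalgebra cB ∧
      ∃ φ : Nor K V ≃ₗc[K] BLRep K V,
        (∀ (f : Nor K V) (n : ℕ), (φ f).1 (Polynomial.X ^ n) = combValue f.1 n) ∧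
        (∀ (f : Nor K V) (σ : GenTree K V), σ.Normal → σ.Generates f.1 →
          ∀ (t : GradingTree) (α : Fin t.leaf → Bool),
            (φ f).1 (Polynomial.X ^ GenTree.projDeg α) = σ.projValue t α) ∧
        (∀ f : Nor K V, blProj (φ f) = norProj f) := by
  obtain ⟨cN, hN⟩ := exists_isNorCoalgebra K V
  obtain ⟨cB, hB⟩ := exists_isBLCoalgebra K V
  obtain ⟨φ, hφ⟩ := exists_coalgEquiv hN hB
  refine ⟨cN, cB, hN, hB, φ, fun f n => ?_, fun f σ hσ hf t α => ?_, fun f => ?_⟩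
  · rw [hφ, norToBL_apply, combMap_X_pow]
  · rw [hφ, norToBL_apply, combMap_eq_projValue ((GenTree.normal_iff σ).1 hσ).1 hf]
  · refine (TensorAlgebra.ι_leftInverse (R := K) (M := V)).injective ?_
    rw [ι_blProj, hφ, norProj, ι_rootValue_fst, norToBL_apply, ← combMap_X_pow, pow_one]
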